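/- Let $N\ge 1$ and let $G:\mathbb{R}^N\to\mathbb{R}$ satisfy: (G1) $G\ge 0$ and $\operatorname{supp}G=\mathbb{R}^N$; (G2) $G\in W^{1,1}(\mathbb{R}^N)\cap L^\infty(\mathbb{R}^N)\cap C^2(\mathbb{R}^N)$ with $\|G\|_{L^1}=1$; (G3) $G$ is radially symmetric, $G(x)=g(|x|)$, with $g'(r)<0$ for all $r>0$; (G4) $g''(0)<0$ and $\lim_{r\to\infty}g(r)=0$. For $R>0$ let $Y_R=\{f\in C([0,R]) : f(R)=0\}$ (real-valued functions, supremum norm) and let $\mathcal{G}_R$ be the linear operator on $Y_R$ $$\mathcal{G}_R[f](r)=\int_0^R\Big(\int_{\partial B_s(0)}\big(G(re_1-y)-G(Re_1-y)\big)\,d\sigma(y)\Big)f(s)\,ds ,$$ where $e_1$ is the first unit vector and $\sigma$ is the surface measure. Let $\omega_N$ denote the surface area of the unit sphere of $\mathbb{R}^N$. Then for every $R>0$ the operator $\mathcal{G}_R$ is compact, and there is a unique function $\rho:\mathbb{R}^N\to\mathbb{R}$ such that $\rho$ is a continuous probability density on $\mathbb{R}^N$ that is radially symmetric, $\rho(x)=\tilde\rho(|x|)$,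 of class $C^2$ on $\overline{B_R(0)}$, with $\operatorname{supp}\rho=\overline{B_R(0)}$, $\tilde\rho'(r)\le 0$ for $0\le r\le R$ (one-sided derivatives at the endpoints), $\tilde\rho''(0)<0$, and such that for some $\varepsilon>0$ $$\varepsilon\rho(x)=(G*\rho)(x)-(G*\rho)(R)\qquad\text{for all }x\in\overline{B_R(0)},$$ where $(G*\rho)(R)$ is the constant value of $G*\rho$ on $\partial B_R(0)$. The number $\varepsilon=\varepsilon(R)$ is also unique. Moreover, $\tilde\rho|_{[0,R]}\in Y_R$ is an eigenfunction of $\mathcal{G}_R$ with eigenvalue $\varepsilon(R)$; $\varepsilon(R)$ is the largest eigenvalue of $\mathcal{G}_R$; every other eigenvalue $\varepsilon'$ of $\mathcal{G}_R$ satisfies $|\varepsilon'|<\varepsilon(R)$; and every eigenfunction $f\ne\tilde\rho|_{[0,R]}$ of $\mathcal{G}_R$ in $Y_R$ with $\int_0^R f(r)\,\omega_N r^{N-1}\,dr=1$ has an eigenvalue $\varepsilon'$ with $|\varepsilon'|<\varepsilon(R)$. -/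

import Mathlib

open MeasureTheory Set Filter Topology Convolution

noncomputable section

namespace KreinRutman

/-- Euclidean space `ℝ^N`. -/
abbrev E (N : ℕ) : Type := EuclideanSpace ℝ (Fin N)

/-- The first unit vector `e₁` of `ℝ^N`, `N ≥ 1`. -/
def e1 (N : ℕ) [NeZero N] : E N := EuclideanSpace.single 0 1

/-- `f` is radially symmetric. -/
def IsRadial {N : ℕ} (f : E N → ℝ) : Prop := ∀ x y : E N, ‖x‖ = ‖y‖ → f x = f y

/-- The radial representative `r ↦ f (r e₁)` of `f`; for radially symmetric `f` one has
`f x = profile f ‖x‖`. It is defined on all of `ℝ` (as an even function if `f` is radial), so that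
its derivatives at `0` are the ordinary two-sided ones. -/
def profile {N : ℕ} [NeZero N] (f : E N → ℝ) (r : ℝ) : ℝ := f (r • e1 N)

/-- The standing assumptions on the interaction potential `G`. Since `G` is of class `C²`, its weak
gradient is the classical one, so `G ∈ W^{1,1}` says that `G` and its derivative are integrable. -/
structure IsPotential {N : ℕ} [NeZero N] (G : E N → ℝ) : Prop where
  nonneg : ∀ x, 0 ≤ G x
  supp_eq : tsupport G = univ
  contDiff : ContDiff ℝ 2 G
  integrable : Integrable G
  integrable_fderiv : Integrable (fderiv ℝ G)
  memLp_top : MemLp G ⊤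
  norm_eq_one : ∫ x, ‖G x‖ = 1
  radial : IsRadial G
  deriv_neg : ∀ r : ℝ, 0 < r → deriv (profile G) r < 0
  deriv2_neg : iteratedDeriv 2 (profile G) 0 < 0
  tendsto_zero : Tendsto (profile G) atTop (𝓝 0)

theorem IsPotential.continuous {N : ℕ} [NeZero N] {G : E N → ℝ} (hG : IsPotential G) :
    Continuous G := hG.contDiff.continuous

/-- The surface integral `∫_{∂B_s(0)} h dσ`, `s ≥ 0`, where `σ` is the surface measure. -/
def sphereIntegral {N : ℕ} (s : ℝ) (h : E N → ℝ) : ℝ :=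
  s ^ (N - 1) * ∫ w : Metric.sphere (0 : E N) 1, h (s • (w : E N)) ∂(volume : Measure (E N)).toSphere

/-- The surface area `ω_N` of the unit sphere of `ℝ^N`. -/
def sphereArea (N : ℕ) : ℝ := ((volume : Measure (E N)).toSphere).real univ

/-- The convolution `G * ρ`. -/
def conv {N : ℕ} (G ρ : E N → ℝ) : E N → ℝ := G ⋆[ContinuousLinearMap.mul ℝ ℝ, volume] ρ

/-- The properties demanded of the density: `ρ` is continuous on `ℝ^N`, of class `C²` on the closed
ball of radius `R`, a probability density, with support that ball, radially symmetric, and its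
radial representative has non-positive first derivative on `[0, R]` (one-sided at the endpoints; for
`r > R` it vanishes) and negative second derivative at `0`. -/
structure IsAdmissible {N : ℕ} [NeZero N] (R : ℝ) (ρ : E N → ℝ) : Prop where
  continuous : Continuous ρ
  contDiffOn : ContDiffOn ℝ 2 ρ (Metric.closedBall 0 R)
  nonneg : ∀ x, 0 ≤ ρ x
  integrable : Integrable ρ
  integral_eq_one : ∫ x, ρ x = 1
  supp_eq : tsupport ρ = Metric.closedBall 0 R
  radial : IsRadial ρ
  deriv_nonpos : ∀ r ∈ Icc (0 : ℝ) R, derivWithin (profile ρ) (Icc 0 R) r ≤ 0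
  deriv2_neg : iteratedDeriv 2 (profile ρ) 0 < 0

/-- `ε ρ(x) = (G * ρ)(x) - (G * ρ)(R)` in the closed ball of radius `R`; here `(G * ρ)(R)` is the
value of the radially symmetric function `G * ρ` on the sphere of radius `R`. -/
def Solves {N : ℕ} [NeZero N] (G : E N → ℝ) (R : ℝ) (ρ : E N → ℝ) (ε : ℝ) : Prop :=
  ∀ x ∈ Metric.closedBall (0 : E N) R, ε * ρ x = conv G ρ x - profile (conv G ρ) R

/-- The Banach space `Y_R` of continuous functions on `[0, R]` that vanish at `R`, with the
supremum norm. -/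
def Y (R : ℝ) : Submodule ℝ C(Icc (0 : ℝ) R, ℝ) where
  carrier := {f | ∀ r : Icc (0 : ℝ) R, (r : ℝ) = R → f r = 0}
  add_mem' := fun hf hg r hr => by simp [hf r hr, hg r hr]
  zero_mem' := fun r _ => rfl
  smul_mem' := fun c f hf r hr => by simp [hf r hr]

/-- The kernel `∫_{∂B_s(0)} (G(r e₁ - y) - G(R e₁ - y)) dσ(y)`. -/
def kernel {N : ℕ} [NeZero N] (G : E N → ℝ) (R r s : ℝ) : ℝ :=
  sphereIntegral s fun y => G (r • e1 N - y) - G (R • e1 N - y)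

theorem continuous_kernel {N : ℕ} [NeZero N] {G : E N → ℝ} (hG : Continuous G) (R : ℝ) :
    Continuous fun p : ℝ × ℝ => kernel G R p.1 p.2 := by
  have h := continuous_parametric_integral_of_continuous
    (μ := (volume : Measure (E N)).toSphere) (s := univ)
    (f := fun (p : ℝ × ℝ) (w : Metric.sphere (0 : E N) 1) =>
      G (p.1 • e1 N - p.2 • (w : E N)) - G (R • e1 N - p.2 • (w : E N)))
    (by unfold Function.uncurry; fun_prop) isCompact_univ
  simp only [Measure.restrict_univ] at h
  unfold kernel sphereIntegral
  exact (continuous_snd.pow _).mul h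

/-- The operator `𝒢_R[f](r) = ∫_0^R (∫_{∂B_s(0)} G(r e₁ - y) - G(R e₁ - y) dσ(y)) f(s) ds` on
`Y_R`; `IccExtend` only serves to read `f` as a function on `ℝ`. -/
def opG {N : ℕ} [NeZero N] {G : E N → ℝ} (hG : Continuous G) {R : ℝ} (hR : 0 ≤ R) :
    Y R →ₗ[ℝ] Y R where
  toFun f :=
    ⟨{ toFun := fun r => ∫ s in (0 : ℝ)..R, kernel G R r s * IccExtend hR (f : C(Icc 0 R, ℝ)) s
       continuous_toFun := by
        have hk := continuous_kernel hG R
        have hf : Continuous (IccExtend hR (f : C(Icc 0 R, ℝ))) :=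
          (f : C(Icc 0 R, ℝ)).continuous.Icc_extend'
        refine intervalIntegral.continuous_parametric_intervalIntegral_of_continuous' ?_ 0 R
        unfold Function.uncurry
        exact (hk.comp ((continuous_subtype_val.comp continuous_fst).prodMk continuous_snd)).mul
          (hf.comp continuous_snd) },
     fun r hr => by simp [hr, kernel, sphereIntegral]⟩
  map_add' f g := by
    have hk := continuous_kernel hG R
    ext r
    have hk' : Continuous fun s => kernel G R r s := hk.comp (continuous_const.prodMk continuous_id)
    have hf : ∀ f : Y R, IntervalIntegrable
        (fun s => kernel G R r s * IccExtend hR (f : C(Icc 0 R, ℝ)) s) volume 0 R := fun f =>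
      (hk'.mul (f : C(Icc 0 R, ℝ)).continuous.Icc_extend').intervalIntegrable 0 R
    simp only [Submodule.coe_add, ContinuousMap.coe_mk, ContinuousMap.add_apply]
    rw [← intervalIntegral.integral_add (hf f) (hf g)]
    refine intervalIntegral.integral_congr fun s _ => ?_
    simp [IccExtend, mul_add]
  map_smul' c f := by
    ext r
    simp only [RingHom.id_apply, Submodule.coe_smul, ContinuousMap.coe_mk,
      ContinuousMap.smul_apply, smul_eq_mul]
    rw [← intervalIntegral.integral_const_mul]
    refine intervalIntegral.integral_congr fun s _ => ?_
    simp [IccExtend]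
    ring

/-- The mass `∫_0^R f(r) ω_N r^{N-1} dr` of the radial density with representative `f`
(which is extended by zero beyond `R`). -/
def radialMass (N : ℕ) {R : ℝ} (hR : 0 ≤ R) (f : Y R) : ℝ :=
  ∫ r in (0 : ℝ)..R, IccExtend hR (f : C(Icc 0 R, ℝ)) r * sphereArea N * r ^ (N - 1)

end KreinRutman

end

/-! The eigenvalue problem becomes transparent after differentiation. Write f(r) = ∫_r^R u and let F
be the radial function with representative f, zero beyond R. Moving the derivative of G * F onto F
and passing to polar coordinates gives (G * F)'(r) = -∫_0^R s^(N-1) A(r,s) u(s) ds, where A(r,s) =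
∫_{|w|=1} G(r e₁ - s w) w₁ dσ(w). Hence taking primitives intertwines 𝒢_R with the operator T of
kernel s^(N-1) A(r,s) (`opG_primitive`). Since G is C², every eigenfunction of 𝒢_R with nonzero
eigenvalue is such a primitive (`exists_eq_primitive`), and the radially nonincreasing ones are
those with u ≥ 0.

The kernel A is symmetric, and averaging over w and -w yields c r t ≤ A(r,t) ≤ C r with c > 0
(`IsPotential.le_angularKernel`, `angularKernel_le`). The lower bound is where g' < 0 and g''(0) < 0
enter: together they make g + c r² decreasing on [0, 2R] for a small c > 0.

So T is compact, symmetric for the weight t^(N-1), and maps each nonzero u ≥ 0 to a function bounded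
below by a multiple of r. A Collatz–Wielandt argument (`exists_eigenfunction`) gives v ≥ 0 with T v
= ε v, ε > 0. Pairing with v shows that ε is the only eigenvalue with a nonnegative eigenfunction,
that |μ| ≤ ε for all eigenvalues, that |μ| = ε forces μ = ε and a constant sign
(`abs_eigenvalue_le`), and hence that ε is simple (`eigenfunction_unique`). The density ρ is the
primitive of v with mass one. -/

noncomputable section

namespace KreinRutman

/-! ### Compactness of integral operators with continuous kernel -/

/-- The integral operator `f ↦ ∫_0^R κ(·, s) f(s) ds` on `C([0, R])`. -/
def integralOp {R : ℝ} (hR : 0 ≤ R) {κ : ℝ → ℝ → ℝ}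
    (hκ : Continuous fun p : ℝ × ℝ => κ p.1 p.2) :
    C(Icc (0 : ℝ) R, ℝ) →ₗ[ℝ] C(Icc (0 : ℝ) R, ℝ) where
  toFun f :=
    { toFun := fun r => ∫ s in (0 : ℝ)..R, κ r s * IccExtend hR f s
      continuous_toFun := by
        have hf : Continuous (IccExtend hR f) := f.continuous.Icc_extend'
        refine intervalIntegral.continuous_parametric_intervalIntegral_of_continuous' ?_ 0 R
        unfold Function.uncurry
        exact (hκ.comp ((continuous_subtype_val.comp continuous_fst).prodMk continuous_snd)).mul
          (hf.comp continuous_snd) }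
  map_add' f g := by
    ext r
    have hk' : Continuous fun s => κ r s := hκ.comp (continuous_const.prodMk continuous_id)
    have hf : ∀ f : C(Icc (0 : ℝ) R, ℝ), IntervalIntegrable
        (fun s => κ r s * IccExtend hR f s) volume 0 R := fun f =>
      (hk'.mul f.continuous.Icc_extend').intervalIntegrable 0 R
    simp only [ContinuousMap.coe_mk, ContinuousMap.add_apply]
    rw [← intervalIntegral.integral_add (hf f) (hf g)]
    refine intervalIntegral.integral_congr fun s _ => ?_
    simp [IccExtend, mul_add]
  map_smul' c f := by
    ext r
    simp only [RingHom.id_apply, ContinuousMap.coe_mk, ContinuousMap.smul_apply, smul_eq_mul]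
    rw [← intervalIntegral.integral_const_mul]
    refine intervalIntegral.integral_congr fun s _ => ?_
    simp [IccExtend]
    ring

section

variable {R : ℝ} (hR : 0 ≤ R) {κ : ℝ → ℝ → ℝ} (hκ : Continuous fun p : ℝ × ℝ => κ p.1 p.2)

theorem integralOp_apply (f : C(Icc (0 : ℝ) R, ℝ)) (r : Icc (0 : ℝ) R) :
    integralOp hR hκ f r = ∫ s in (0 : ℝ)..R, κ r s * IccExtend hR f s := rfl

theorem abs_IccExtend_le (f : C(Icc (0 : ℝ) R, ℝ)) (s : ℝ) : |IccExtend hR f s| ≤ ‖f‖ :=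
  f.norm_coe_le_norm _

theorem continuous_slice {κ : ℝ → ℝ → ℝ} (hκ : Continuous fun p : ℝ × ℝ => κ p.1 p.2) (r : ℝ) :
    Continuous fun s => κ r s := hκ.comp (continuous_const.prodMk continuous_id)

/-- An estimate of the values of the integral operator, and of their differences. -/
theorem abs_integral_kernel_le {φ : ℝ → ℝ} {M : ℝ} (hM : ∀ s ∈ Icc (0 : ℝ) R, |φ s| ≤ M)
    (f : C(Icc (0 : ℝ) R, ℝ)) :
    |∫ s in (0 : ℝ)..R, φ s * IccExtend hR f s| ≤ M * ‖f‖ * R := by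
  have := intervalIntegral.norm_integral_le_of_norm_le_const (a := (0 : ℝ)) (b := R)
    (f := fun s => φ s * IccExtend hR f s) (C := M * ‖f‖) fun s hs => by
      rw [uIoc_of_le hR] at hs
      have hs' : s ∈ Icc (0 : ℝ) R := ⟨hs.1.le, hs.2⟩
      rw [Real.norm_eq_abs, abs_mul]
      exact mul_le_mul (hM s hs') (abs_IccExtend_le hR f s) (abs_nonneg _)
        ((abs_nonneg _).trans (hM s hs'))
  simpa [abs_of_nonneg hR] using this

/-- Arzelà–Ascoli: the image of the unit ball is bounded by M R, with M a bound for κ on the square,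
and is equicontinuous because κ is uniformly continuous there. -/
theorem isCompactOperator_integralOp : IsCompactOperator (integralOp hR hκ) := by
  rw [isCompactOperator_iff_image_closedBall_subset_compact _ one_pos]
  obtain ⟨M, hM⟩ := (isCompact_Icc.prod isCompact_Icc :
    IsCompact (Icc (0 : ℝ) R ×ˢ Icc (0 : ℝ) R)).exists_bound_of_continuousOn hκ.continuousOn
  have huc := (isCompact_Icc.prod isCompact_Icc :
    IsCompact (Icc (0 : ℝ) R ×ˢ Icc (0 : ℝ) R)).uniformContinuousOn_of_continuous hκ.continuousOn
  rw [Metric.uniformContinuousOn_iff] at huc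
  let e := ContinuousMap.isometryEquivBoundedOfCompact (Icc (0 : ℝ) R) ℝ
  let S := integralOp hR hκ '' Metric.closedBall 0 1
  have hnorm : ∀ f ∈ Metric.closedBall (0 : C(Icc (0 : ℝ) R, ℝ)) 1, ‖f‖ ≤ 1 := fun f hf => by
    simpa using hf
  have hS : IsCompact (closure (e '' S)) := by
    refine BoundedContinuousFunction.arzela_ascoli (Metric.closedBall 0 (M * R))
      (isCompact_closedBall _ _) _ ?_ ?_
    · rintro _ x ⟨_, ⟨f, hf, rfl⟩, rfl⟩
      have h := abs_integral_kernel_le hR (φ := fun s => κ x s) (M := M)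
        (fun s hs => hM (x, s) ⟨x.2, hs⟩) f
      have hM0 : 0 ≤ M := (norm_nonneg _).trans (hM (0, 0) ⟨⟨le_rfl, hR⟩, ⟨le_rfl, hR⟩⟩)
      rw [mem_closedBall_zero_iff, Real.norm_eq_abs]
      refine h.trans ?_
      have := mul_le_mul_of_nonneg_left (hnorm f hf) hM0
      nlinarith
    · intro x₀
      rw [Metric.equicontinuousAt_iff_pair]
      intro ε hε
      -- The denominator R + 1 rather than R covers R = 0 and makes the final bound ε R / (R + 1)
      -- strictly less than ε.
      obtain ⟨δ, hδ, hδ'⟩ := huc (ε / (R + 1)) (by positivity)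
      refine ⟨Metric.ball x₀ (δ / 2), Metric.ball_mem_nhds _ (by positivity), ?_⟩
      rintro x hx y hy ⟨_, ⟨_, ⟨f, hf, rfl⟩, rfl⟩⟩
      have hxy : dist (x : ℝ) y < δ := by
        have := dist_triangle_right x y x₀
        rw [Metric.mem_ball] at hx hy
        have h' : dist (x : ℝ) y = dist x y := rfl
        linarith
      have h := abs_integral_kernel_le hR (φ := fun s => κ x s - κ y s) (M := ε / (R + 1))
        (fun s hs => by
          refine (hδ' (x, s) ⟨x.2, hs⟩ (y, s) ⟨y.2, hs⟩ ?_).le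
          simpa [Prod.dist_eq] using hxy) f
      have heq : integralOp hR hκ f x - integralOp hR hκ f y
          = ∫ s in (0 : ℝ)..R, (κ x s - κ y s) * IccExtend hR f s := by
        rw [integralOp_apply, integralOp_apply, ← intervalIntegral.integral_sub]
        · simp only [sub_mul]
        all_goals exact ((continuous_slice hκ _).mul f.continuous.Icc_extend').intervalIntegrable _ _
      change dist (integralOp hR hκ f x) (integralOp hR hκ f y) < ε
      rw [Real.dist_eq, heq]
      refine h.trans_lt ?_
      have h1 : ε / (R + 1) * ‖f‖ * R ≤ ε / (R + 1) * 1 * R := by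
        have := hnorm f hf
        gcongr
      refine h1.trans_lt ?_
      rw [mul_one, div_mul_eq_mul_div, div_lt_iff₀ (by positivity)]
      nlinarith
  refine ⟨e.symm '' closure (e '' S), hS.image e.symm.continuous, ?_⟩
  intro g hg
  exact ⟨e g, subset_closure ⟨g, hg, rfl⟩, e.symm_apply_apply g⟩

end

theorem isClosed_Y (R : ℝ) : IsClosed (Y R : Set C(Icc (0 : ℝ) R, ℝ)) := by
  have : (Y R : Set C(Icc (0 : ℝ) R, ℝ)) =
      ⋂ (r : Icc (0 : ℝ) R) (_ : (r : ℝ) = R), {f | f r = 0} := by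
    ext f
    simp [Y]
  rw [this]
  exact isClosed_iInter fun r => isClosed_iInter fun _ =>
    isClosed_eq (continuous_eval_const r) continuous_const

/-- The operator is the restriction of an integral operator on C([0, R]) whose values on `Y R` lie
in the closed subspace `Y R`, so compactness is inherited. -/
theorem isCompactOperator_opG {N : ℕ} [NeZero N] {G : E N → ℝ} (hG : Continuous G) {R : ℝ}
    (hR : 0 ≤ R) : IsCompactOperator (opG hG hR) :=
  ((isCompactOperator_integralOp hR (continuous_kernel hG R)).comp_clm
    (Y R).subtypeL).codRestrict (V := Y R) (fun f => (opG hG hR f).2) (isClosed_Y R)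

/-! ### Jentzsch's theorem: existence of a positive eigenfunction -/

theorem IccExtend_coe {R : ℝ} (hR : 0 ≤ R) (u : C(Icc (0 : ℝ) R, ℝ)) (t : Icc (0 : ℝ) R) :
    IccExtend hR u t = u t := IccExtend_val hR u t

theorem continuous_IccExtend {R : ℝ} (hR : 0 ≤ R) (u : C(Icc (0 : ℝ) R, ℝ)) :
    Continuous (IccExtend hR u) := u.continuous.Icc_extend'

/-- The weight t ^ n and the bound c r t may degenerate at t = 0, so strict positivity of integrals
needs a point of nonvanishing away from 0. -/
theorem exists_pos_ne_zero {R : ℝ} (hR : 0 < R) {u : C(Icc (0 : ℝ) R, ℝ)} (hu : u ≠ 0) :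
    ∃ t : Icc (0 : ℝ) R, 0 < (t : ℝ) ∧ u t ≠ 0 := by
  by_contra! h
  refine hu ?_
  have h0 : EqOn (IccExtend hR.le u) 0 (Ioc 0 R) := fun t ht => by
    rw [IccExtend_of_mem hR.le u ⟨ht.1.le, ht.2⟩]
    exact h ⟨t, ht.1.le, ht.2⟩ ht.1
  have h1 := h0.closure (continuous_IccExtend hR.le u) continuous_zero
  rw [closure_Ioc hR.ne] at h1
  ext t
  have := h1 t.2
  rwa [IccExtend_coe] at this

/-- A continuous symmetric kernel on `[0, R]²` that vanishes on the axes exactly to first order. -/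
structure IsPositiveKernel (R : ℝ) (A : ℝ → ℝ → ℝ) : Prop where
  continuous : Continuous fun p : ℝ × ℝ => A p.1 p.2
  symm : ∀ r t, A r t = A t r
  lower : ∃ c > 0, ∀ r ∈ Icc 0 R, ∀ t ∈ Icc 0 R, c * r * t ≤ A r t
  upper : ∃ C, ∀ r ∈ Icc 0 R, ∀ t ∈ Icc 0 R, A r t ≤ C * r

namespace IsPositiveKernel

variable {R : ℝ} {A : ℝ → ℝ → ℝ} (hA : IsPositiveKernel R A) (hR : 0 < R) (n : ℕ)

include hA in
theorem nonneg {r t : ℝ} (hr : r ∈ Icc 0 R) (ht : t ∈ Icc 0 R) : 0 ≤ A r t := by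
  obtain ⟨c, hc, h⟩ := hA.lower
  exact (mul_nonneg (mul_nonneg hc.le hr.1) ht.1).trans (h r hr t ht)

include hA in
theorem continuous_weighted : Continuous fun p : ℝ × ℝ => p.2 ^ n * A p.1 p.2 :=
  (continuous_snd.pow n).mul hA.continuous

/-- The integral operator with kernel `t ^ n * A r t`. -/
def op : C(Icc (0 : ℝ) R, ℝ) →ₗ[ℝ] C(Icc (0 : ℝ) R, ℝ) :=
  integralOp hR.le (κ := fun r t => t ^ n * A r t) (continuous_weighted hA n)

theorem op_apply (u : C(Icc (0 : ℝ) R, ℝ)) (r : Icc (0 : ℝ) R) :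
    hA.op hR n u r = ∫ t in (0 : ℝ)..R, t ^ n * A r t * IccExtend hR.le u t := rfl

theorem isCompactOperator_op : IsCompactOperator (hA.op hR n) :=
  isCompactOperator_integralOp hR.le _

include hA in
theorem continuous_integrand (u : C(Icc (0 : ℝ) R, ℝ)) (r : ℝ) :
    Continuous fun t => t ^ n * A r t * IccExtend hR.le u t :=
  (continuous_slice (κ := fun r t => t ^ n * A r t) (hA.continuous_weighted n) r).mul
    (continuous_IccExtend hR.le u)

theorem op_mono {u w : C(Icc (0 : ℝ) R, ℝ)} (h : u ≤ w) : hA.op hR n u ≤ hA.op hR n w := by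
  refine ContinuousMap.le_def.2 fun r => ?_
  rw [op_apply, op_apply]
  refine intervalIntegral.integral_mono_on hR.le
    ((hA.continuous_integrand hR n u r).intervalIntegrable _ _)
    ((hA.continuous_integrand hR n w r).intervalIntegrable _ _) fun t ht => ?_
  rw [IccExtend_of_mem _ _ ht, IccExtend_of_mem _ _ ht]
  exact mul_le_mul_of_nonneg_left (h ⟨t, ht⟩)
    (mul_nonneg (pow_nonneg ht.1 n) (hA.nonneg r.2 ht))

theorem op_nonneg {u : C(Icc (0 : ℝ) R, ℝ)} (h : 0 ≤ u) : 0 ≤ hA.op hR n u := by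
  simpa using hA.op_mono hR n h

/-- Strong positivity: the lower bound on the kernel gives T u(r) ≥ c r ∫ t^(n+1) u(t) dt, and the
integral is positive. The comparison function r plays the role of an interior point of the cone. -/
theorem exists_mul_le_op {u : C(Icc (0 : ℝ) R, ℝ)} (h : 0 ≤ u) (hu : u ≠ 0) :
    ∃ δ > 0, ∀ r : Icc (0 : ℝ) R, δ * r ≤ hA.op hR n u r := by
  obtain ⟨c, hc, hlow⟩ := hA.lower
  obtain ⟨t₀, ht₀, hut₀⟩ := exists_pos_ne_zero hR hu
  have hcont : Continuous fun t => t ^ n * t * IccExtend hR.le u t :=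
    ((continuous_id.pow n).mul continuous_id).mul (continuous_IccExtend hR.le u)
  have hI : 0 < ∫ t in (0 : ℝ)..R, t ^ n * t * IccExtend hR.le u t := by
    refine intervalIntegral.integral_pos hR hcont.continuousOn (fun t ht => ?_) ⟨t₀, t₀.2, ?_⟩
    · exact mul_nonneg (mul_nonneg (pow_nonneg ht.1.le n) ht.1.le) (h _)
    · rw [IccExtend_coe]
      exact mul_pos (mul_pos (pow_pos ht₀ n) ht₀) (lt_of_le_of_ne (h t₀) hut₀.symm)
  refine ⟨c * ∫ t in (0 : ℝ)..R, t ^ n * t * IccExtend hR.le u t, mul_pos hc hI, fun r => ?_⟩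
  rw [op_apply, mul_right_comm, ← intervalIntegral.integral_const_mul]
  refine intervalIntegral.integral_mono_on hR.le ((hcont.const_mul _).intervalIntegrable _ _)
    ((hA.continuous_integrand hR n u r).intervalIntegrable _ _) fun t ht => ?_
  have h1 := mul_le_mul_of_nonneg_left (hlow r r.2 t ht) (pow_nonneg ht.1 n)
  have h2 := mul_le_mul_of_nonneg_right h1 (h (projIcc 0 R hR.le t))
  calc c * r * (t ^ n * t * IccExtend hR.le u t)
      = t ^ n * (c * r * t) * u (projIcc 0 R hR.le t) := by simp [IccExtend]; ring
    _ ≤ _ := h2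

theorem exists_op_le_mul (u : C(Icc (0 : ℝ) R, ℝ)) :
    ∃ C > 0, ∀ r : Icc (0 : ℝ) R, hA.op hR n u r ≤ C * r := by
  obtain ⟨C, hup⟩ := hA.upper
  have key : ∀ r : Icc (0 : ℝ) R, hA.op hR n u r ≤ R ^ n * (C * r) * ‖u‖ * R := fun r => by
    refine (le_abs_self _).trans (abs_integral_kernel_le hR.le (fun s hs => ?_) u)
    rw [abs_of_nonneg (mul_nonneg (pow_nonneg hs.1 n) (hA.nonneg r.2 hs))]
    exact mul_le_mul (pow_le_pow_left₀ hs.1 hs.2 n) (hup r r.2 s hs) (hA.nonneg r.2 hs)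
      (pow_nonneg hR.le n)
  -- The absolute value plus one only serves to make the constant positive.
  refine ⟨|R ^ n * C * ‖u‖ * R| + 1, by positivity, fun r => (key r).trans ?_⟩
  have h1 := mul_le_mul_of_nonneg_right
    ((le_abs_self (R ^ n * C * ‖u‖ * R)).trans (le_add_of_nonneg_right zero_le_one)) r.2.1
  linarith

/-- If `T u ≥ μ u` for some `u ≥ 0`, `u ≠ 0` but `T u ≠ μ u`, then `μ` can be increased. -/
theorem exists_gt_of_ne {u : C(Icc (0 : ℝ) R, ℝ)} {μ : ℝ} (hμ : 0 < μ) (h : 0 ≤ u) (hu : u ≠ 0)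
    (hle : μ • u ≤ hA.op hR n u) (hne : hA.op hR n u ≠ μ • u) :
    ∃ w : C(Icc (0 : ℝ) R, ℝ), 0 ≤ w ∧ w ≠ 0 ∧ ∃ μ' > μ, μ' • w ≤ hA.op hR n w := by
  set T := hA.op hR n
  obtain ⟨δ, hδ, hlow⟩ := hA.exists_mul_le_op hR n (u := T u - μ • u) (sub_nonneg.2 hle)
    (sub_ne_zero.2 hne)
  obtain ⟨C, hC, hup⟩ := hA.exists_op_le_mul hR n u
  -- The improved test function is T u: T(T u) - μ T u = T(T u - μ u) ≥ δ r ≥ (δ/C) T u, since T u ≤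
  -- C r.
  refine ⟨T u, hA.op_nonneg hR n h, fun h0 => hu ?_, μ + δ / C,
    lt_add_of_pos_right μ (div_pos hδ hC), ContinuousMap.le_def.2 fun r => ?_⟩
  · rw [h0] at hle
    ext t
    have h1 := ContinuousMap.le_def.1 hle t
    simp only [ContinuousMap.smul_apply, smul_eq_mul, ContinuousMap.zero_apply] at h1 ⊢
    have h2 : 0 ≤ u t := h t
    nlinarith
  · have h1 := hlow r
    have h2 := hup r
    change δ * r ≤ T (T u - μ • u) r at h1
    rw [map_sub, map_smul] at h1
    simp only [ContinuousMap.sub_apply, ContinuousMap.smul_apply, smul_eq_mul] at h1 ⊢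
    have h3 : δ / C * T u r ≤ δ / C * (C * r) := mul_le_mul_of_nonneg_left h2 (by positivity)
    have h4 : δ / C * (C * r) = δ * r := by field_simp
    linarith

/-- **Jentzsch's theorem**, existence of a nonnegative eigenfunction. -/
theorem exists_eigenfunction :
    ∃ μ : ℝ, 0 < μ ∧ ∃ v : C(Icc (0 : ℝ) R, ℝ), 0 ≤ v ∧ v ≠ 0 ∧ hA.op hR n v = μ • v := by
  set T := hA.op hR n
  have hcomp : IsCompactOperator T := hA.isCompactOperator_op hR n
  let T' := ContinuousLinearMap.mkOfIsCompactOperator hcomp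
  have hmono : ∀ {a b : C(Icc (0 : ℝ) R, ℝ)}, 0 ≤ a → a ≤ b → ‖a‖ ≤ ‖b‖ := fun {a b} ha hab => by
    refine (ContinuousMap.norm_le _ (norm_nonneg _)).2 fun x => ?_
    rw [Real.norm_eq_abs, abs_of_nonneg (ContinuousMap.le_def.1 ha x)]
    exact (ContinuousMap.le_def.1 hab x).trans ((le_abs_self _).trans (b.norm_coe_le_norm x))
  -- Collatz–Wielandt: the eigenvalue is the supremum of the μ for which T u ≥ μ u has a nonnegative
  -- solution of norm one.
  let Λ : Set ℝ := {μ | 0 < μ ∧ ∃ u : C(Icc (0 : ℝ) R, ℝ), 0 ≤ u ∧ ‖u‖ = 1 ∧ μ • u ≤ T u}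
  have hΛ : ∀ {μ : ℝ} {u : C(Icc (0 : ℝ) R, ℝ)}, 0 < μ → 0 ≤ u → u ≠ 0 → μ • u ≤ T u → μ ∈ Λ := by
    intro μ u hμ h0 hu hle
    have hn : 0 < ‖u‖ := norm_pos_iff.2 hu
    refine ⟨hμ, ‖u‖⁻¹ • u, ?_, ?_, ContinuousMap.le_def.2 fun x => ?_⟩
    · exact smul_nonneg (inv_nonneg.2 hn.le) h0
    · rw [norm_smul, norm_inv, norm_norm, inv_mul_cancel₀ hn.ne']
    · rw [map_smul]
      have := mul_le_mul_of_nonneg_left (ContinuousMap.le_def.1 hle x) (inv_nonneg.2 hn.le)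
      simp only [ContinuousMap.smul_apply, smul_eq_mul] at this ⊢
      linarith
  have hbdd : BddAbove Λ := by
    refine ⟨‖T'‖, ?_⟩
    rintro μ ⟨hμ, u, h0, hu, hle⟩
    have h1 := hmono (smul_nonneg hμ.le h0) hle
    rw [norm_smul, hu, mul_one, Real.norm_eq_abs, abs_of_pos hμ] at h1
    have h2 : ‖T u‖ ≤ ‖T'‖ * ‖u‖ := T'.le_opNorm u
    rw [hu, mul_one] at h2
    exact h1.trans h2
  have hne : Λ.Nonempty := by
    let u : C(Icc (0 : ℝ) R, ℝ) := ⟨fun x => (x : ℝ), continuous_subtype_val⟩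
    have h0 : 0 ≤ u := fun x => x.2.1
    have hu : u ≠ 0 := fun h => hR.ne' (DFunLike.congr_fun h ⟨R, hR.le, le_rfl⟩)
    obtain ⟨δ, hδ, h⟩ := hA.exists_mul_le_op hR n h0 hu
    exact ⟨δ, hΛ hδ h0 hu h⟩
  obtain ⟨m, -, hm, hmΛ⟩ := exists_seq_tendsto_sSup hne hbdd
  choose hm0 u hu0 hu1 hu using hmΛ
  obtain ⟨K, hK, hTK⟩ := hcomp.image_closedBall_subset_compact (f := T) 1
  -- Compactness makes the images T u_k converge along a subsequence, not the u_k themselves. The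
  -- limit of the images serves as v, because T preserves the inequality T u_k ≥ m_k u_k.
  obtain ⟨v, -, φ, hφ, hv⟩ := hK.tendsto_subseq (x := fun k => T (u k))
    fun k => hTK ⟨u k, by simp [hu1 k], rfl⟩
  set μ := sSup Λ
  have hμ : 0 < μ := (hm0 0).trans_le (le_csSup hbdd ⟨hm0 0, u 0, hu0 0, hu1 0, hu 0⟩)
  have hmφ : Tendsto (fun k => m (φ k)) atTop (𝓝 μ) := hm.comp hφ.tendsto_atTop
  have heval : ∀ {x : ℕ → C(Icc (0 : ℝ) R, ℝ)} {y}, Tendsto x atTop (𝓝 y) → ∀ r,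
      Tendsto (fun k => x k r) atTop (𝓝 (y r)) := fun h r =>
    ((continuous_eval_const r).tendsto _).comp h
  have hv0 : 0 ≤ v := fun r =>
    ge_of_tendsto' (heval hv r) fun k => hA.op_nonneg hR n (hu0 (φ k)) r
  have hvn : v ≠ 0 := by
    -- The norms ‖T u_k‖ ≥ m_k stay away from 0, so the limit is nonzero.
    have h1 : ∀ k, m (φ k) ≤ ‖T (u (φ k))‖ := fun k => by
      have := hmono (smul_nonneg (hm0 (φ k)).le (hu0 (φ k))) (hu (φ k))
      rwa [norm_smul, hu1, mul_one, Real.norm_eq_abs, abs_of_pos (hm0 _)] at this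
    have h2 := le_of_tendsto_of_tendsto' hmφ hv.norm h1
    exact norm_pos_iff.1 (hμ.trans_le h2)
  have hle : μ • v ≤ T v := ContinuousMap.le_def.2 fun r => by
    refine le_of_tendsto_of_tendsto' (hmφ.mul (heval hv r))
      (heval ((hcomp.continuous.tendsto v).comp hv) r) fun k => ?_
    have := ContinuousMap.le_def.1 (hA.op_mono hR n (hu (φ k))) r
    rw [map_smul] at this
    exact this
  refine ⟨μ, hμ, v, hv0, hvn, ?_⟩
  -- If T v ≠ μ v, a larger μ' would be admissible, contradicting the supremum.
  by_contra hcon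
  obtain ⟨w, hw0, hwn, μ', hμ', hw⟩ := hA.exists_gt_of_ne hR n hμ hv0 hvn hle hcon
  exact absurd (le_csSup hbdd (hΛ (hμ.trans hμ') hw0 hwn hw)) (not_le.2 hμ')

/-! ### Dominance and simplicity of the eigenvalue, by symmetry of the operator -/

/-- The weighted `L²` pairing `∫_0^R t ^ n u(t) w(t) dt`. -/
def pairing (u w : C(Icc (0 : ℝ) R, ℝ)) : ℝ :=
  ∫ t in (0 : ℝ)..R, t ^ n * (IccExtend hR.le u t * IccExtend hR.le w t)

theorem continuous_pairing_integrand (u w : C(Icc (0 : ℝ) R, ℝ)) :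
    Continuous fun t => t ^ n * (IccExtend hR.le u t * IccExtend hR.le w t) :=
  (continuous_id.pow n).mul ((continuous_IccExtend hR.le u).mul (continuous_IccExtend hR.le w))

theorem pairing_sub_left (u u' w : C(Icc (0 : ℝ) R, ℝ)) :
    pairing hR n (u - u') w = pairing hR n u w - pairing hR n u' w := by
  unfold pairing
  rw [← intervalIntegral.integral_sub
    ((continuous_pairing_integrand hR n u w).intervalIntegrable _ _)
    ((continuous_pairing_integrand hR n u' w).intervalIntegrable _ _)]
  refine intervalIntegral.integral_congr fun t _ => ?_
  simp [IccExtend]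
  ring

theorem pairing_smul_left (a : ℝ) (u w : C(Icc (0 : ℝ) R, ℝ)) :
    pairing hR n (a • u) w = a * pairing hR n u w := by
  unfold pairing
  rw [← intervalIntegral.integral_const_mul]
  refine intervalIntegral.integral_congr fun t _ => ?_
  simp [IccExtend]
  ring

theorem pairing_comm (u w : C(Icc (0 : ℝ) R, ℝ)) : pairing hR n u w = pairing hR n w u := by
  unfold pairing
  simp only [mul_comm (IccExtend hR.le u _)]

theorem pairing_pos {u v : C(Icc (0 : ℝ) R, ℝ)} (h0 : 0 ≤ u) (hu : u ≠ 0)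
    (hv0 : 0 ≤ v) (hv : ∀ t : Icc (0 : ℝ) R, 0 < (t : ℝ) → 0 < v t) : 0 < pairing hR n u v := by
  obtain ⟨t₀, ht₀, hut₀⟩ := exists_pos_ne_zero hR hu
  refine intervalIntegral.integral_pos hR (continuous_pairing_integrand hR n u v).continuousOn
    (fun t ht => mul_nonneg (pow_nonneg ht.1.le n) (mul_nonneg (h0 _) (hv0 _))) ⟨t₀, t₀.2, ?_⟩
  rw [IccExtend_coe, IccExtend_coe]
  exact mul_pos (pow_pos ht₀ n) (mul_pos (lt_of_le_of_ne (h0 t₀) hut₀.symm) (hv t₀ ht₀))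

/-- Fubini together with the symmetry of A: the weight t ^ n makes T symmetric. -/
theorem pairing_op (u w : C(Icc (0 : ℝ) R, ℝ)) :
    pairing hR n (hA.op hR n u) w = pairing hR n u (hA.op hR n w) := by
  have key : ∀ u w : C(Icc (0 : ℝ) R, ℝ), pairing hR n (hA.op hR n u) w =
      ∫ r in (0 : ℝ)..R, ∫ t in (0 : ℝ)..R,
        r ^ n * t ^ n * A r t * IccExtend hR.le u t * IccExtend hR.le w r := fun u w => by
    refine intervalIntegral.integral_congr fun r hr => ?_
    rw [uIcc_of_le hR.le] at hr
    rw [IccExtend_of_mem hR.le (hA.op hR n u) hr, op_apply, ← intervalIntegral.integral_mul_const,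
      ← intervalIntegral.integral_const_mul]
    refine intervalIntegral.integral_congr fun t _ => ?_
    ring
  rw [key, pairing_comm, key, intervalIntegral_intervalIntegral_swap]
  · refine intervalIntegral.integral_congr fun t _ => intervalIntegral.integral_congr fun r _ => ?_
    rw [hA.symm r t]
    ring
  · have hc : Continuous (Function.uncurry fun r t =>
        r ^ n * t ^ n * A r t * IccExtend hR.le u t * IccExtend hR.le w r) :=
      ((((continuous_fst.pow n).mul (continuous_snd.pow n)).mul hA.continuous).mul
        ((continuous_IccExtend hR.le u).comp continuous_snd)).mul
        ((continuous_IccExtend hR.le w).comp continuous_fst)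
    exact (hc.continuousOn.integrableOn_compact (K := uIcc 0 R ×ˢ uIcc 0 R)
      (isCompact_uIcc.prod isCompact_uIcc)).mono_set (prod_mono uIoc_subset_uIcc uIoc_subset_uIcc)

variable {v : C(Icc (0 : ℝ) R, ℝ)} {ε : ℝ}

theorem eigenfunction_pos (hv0 : 0 ≤ v) (hvn : v ≠ 0) (hε : 0 < ε)
    (hv : hA.op hR n v = ε • v) : ∃ δ > 0, ∀ r : Icc (0 : ℝ) R, δ * r ≤ v r := by
  obtain ⟨δ, hδ, h⟩ := hA.exists_mul_le_op hR n hv0 hvn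
  refine ⟨δ / ε, div_pos hδ hε, fun r => ?_⟩
  have := h r
  rw [hv, ContinuousMap.smul_apply, smul_eq_mul] at this
  rw [div_mul_eq_mul_div, div_le_iff₀ hε]
  linarith

theorem abs_op_le (u : C(Icc (0 : ℝ) R, ℝ)) : |hA.op hR n u| ≤ hA.op hR n |u| := by
  refine abs_le'.2 ⟨hA.op_mono hR n (le_abs_self u), ?_⟩
  rw [← map_neg]
  exact hA.op_mono hR n (neg_le_abs u)

/-- If `|T u (R)| = T |u| (R)`, then `u` has constant sign. -/
theorem abs_eq_of_op_abs_eq {u : C(Icc (0 : ℝ) R, ℝ)}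
    (h : hA.op hR n |u| ⟨R, hR.le, le_rfl⟩ = hA.op hR n u ⟨R, hR.le, le_rfl⟩) : |u| = u := by
  by_contra hne
  obtain ⟨δ, hδ, hlow⟩ := hA.exists_mul_le_op hR n (u := |u| - u)
    (sub_nonneg.2 (le_abs_self u)) (sub_ne_zero.2 hne)
  -- If |u| ≠ u, then T(|u| - u) is bounded below by δ r, hence is positive at the endpoint R.
  have := hlow ⟨R, hR.le, le_rfl⟩
  rw [map_sub, ContinuousMap.sub_apply, h, sub_self] at this
  exact absurd this (not_le.2 (mul_pos hδ hR))

section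

variable (hv0 : 0 ≤ v) (hvn : v ≠ 0) (hε : 0 < ε) (hv : hA.op hR n v = ε • v)

include hv0 hvn hε hv

/-- Symmetry gives μ ⟨u, v⟩ = ε ⟨u, v⟩, and ⟨u, v⟩ > 0 because v is positive on (0, R]. -/
theorem eigenvalue_eq_of_nonneg {u : C(Icc (0 : ℝ) R, ℝ)} {μ : ℝ} (h0 : 0 ≤ u) (hu : u ≠ 0)
    (h : hA.op hR n u = μ • u) : μ = ε := by
  obtain ⟨δ, hδ, hpos⟩ := hA.eigenfunction_pos hR n hv0 hvn hε hv
  have hp := pairing_pos hR n h0 hu hv0 fun t ht => (mul_pos hδ ht).trans_le (hpos t)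
  have h1 := hA.pairing_op hR n u v
  rw [h, hv, pairing_smul_left, pairing_comm hR n u (ε • v), pairing_smul_left,
    pairing_comm hR n v u] at h1
  exact mul_right_cancel₀ hp.ne' h1

theorem abs_eigenvalue_le {u : C(Icc (0 : ℝ) R, ℝ)} {μ : ℝ} (hu : u ≠ 0)
    (h : hA.op hR n u = μ • u) : |μ| ≤ ε ∧ (|μ| = ε → μ = ε ∧ (|u| = u ∨ |u| = -u)) := by
  obtain ⟨δ, hδ, hpos⟩ := hA.eigenfunction_pos hR n hv0 hvn hε hv
  have hv' : ∀ t : Icc (0 : ℝ) R, 0 < (t : ℝ) → 0 < v t := fun t ht =>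
    (mul_pos hδ ht).trans_le (hpos t)
  have hu' : |u| ≠ 0 := fun h => hu (by
    ext t
    simpa using DFunLike.congr_fun h t)
  have hp := pairing_pos hR n (abs_nonneg u) hu' hv0 hv'
  -- The defect T|u| - |μ||u| is nonnegative because T|u| ≥ |T u|. Its pairing with v equals (ε -
  -- |μ|) ⟨|u|, v⟩, so |μ| ≤ ε, and equality makes the defect vanish.
  have hd : 0 ≤ hA.op hR n |u| - |μ| • |u| := by
    have h1 := hA.abs_op_le hR n u
    rw [h] at h1
    refine sub_nonneg.2 (ContinuousMap.le_def.2 fun r => ?_)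
    have := ContinuousMap.le_def.1 h1 r
    simpa [abs_mul] using this
  have hpd : pairing hR n (hA.op hR n |u| - |μ| • |u|) v = (ε - |μ|) * pairing hR n |u| v := by
    rw [pairing_sub_left, hA.pairing_op, hv, pairing_comm hR n |u| (ε • v), pairing_smul_left,
      pairing_smul_left, pairing_comm hR n v |u|]
    ring
  have hle : |μ| ≤ ε := by
    by_contra hcon
    have hneg : pairing hR n (hA.op hR n |u| - |μ| • |u|) v < 0 := by
      rw [hpd]
      exact mul_neg_of_neg_of_pos (by linarith) hp
    refine absurd hneg (not_lt.2 ?_)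
    by_cases h0 : hA.op hR n |u| - |μ| • |u| = 0
    · simp [h0, pairing, IccExtend]
    · exact (pairing_pos hR n hd h0 hv0 hv').le
  refine ⟨hle, fun heq => ?_⟩
  have h0 : hA.op hR n |u| - |μ| • |u| = 0 := by
    by_contra h0
    have := pairing_pos hR n hd h0 hv0 hv'
    rw [hpd, heq, sub_self, zero_mul] at this
    exact lt_irrefl _ this
  have hsign : |u| = u ∨ |u| = -u := by
    have h1 := DFunLike.congr_fun (sub_eq_zero.1 h0) (⟨R, hR.le, le_rfl⟩ : Icc (0 : ℝ) R)
    have h2 : |hA.op hR n u ⟨R, hR.le, le_rfl⟩| = hA.op hR n |u| ⟨R, hR.le, le_rfl⟩ := by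
      rw [h1, h]
      simp [abs_mul]
    rcases abs_choice (hA.op hR n u ⟨R, hR.le, le_rfl⟩) with h3 | h3
    · exact .inl (hA.abs_eq_of_op_abs_eq hR n (h2.symm.trans h3))
    · right
      have := hA.abs_eq_of_op_abs_eq hR n (u := -u)
      rw [abs_neg, map_neg] at this
      exact this (h2.symm.trans h3)
  refine ⟨?_, hsign⟩
  rcases hsign with hs | hs
  · exact hA.eigenvalue_eq_of_nonneg hR n hv0 hvn hε hv (hs ▸ abs_nonneg u) hu h
  · refine hA.eigenvalue_eq_of_nonneg hR n hv0 hvn hε hv (u := -u) (hs ▸ abs_nonneg u)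
      (neg_ne_zero.2 hu) ?_
    rw [map_neg, h, smul_neg]

/-- Subtract from u its projection on v. A nonzero remainder would be an eigenfunction for ε, hence
of constant sign, and could not be orthogonal to the positive v. -/
theorem eigenfunction_unique {u : C(Icc (0 : ℝ) R, ℝ)} (h : hA.op hR n u = ε • u) :
    ∃ a : ℝ, u = a • v := by
  obtain ⟨δ, hδ, hpos⟩ := hA.eigenfunction_pos hR n hv0 hvn hε hv
  have hv' : ∀ t : Icc (0 : ℝ) R, 0 < (t : ℝ) → 0 < v t := fun t ht =>
    (mul_pos hδ ht).trans_le (hpos t)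
  have hvv := pairing_pos hR n hv0 hvn hv0 hv'
  set a := pairing hR n u v / pairing hR n v v
  refine ⟨a, ?_⟩
  by_contra hne
  have hw : u - a • v ≠ 0 := sub_ne_zero.2 hne
  have hw' : hA.op hR n (u - a • v) = ε • (u - a • v) := by
    rw [map_sub, map_smul, h, hv, smul_sub, smul_comm]
  have hz : pairing hR n (u - a • v) v = 0 := by
    rw [pairing_sub_left, pairing_smul_left, div_mul_cancel₀ _ hvv.ne', sub_self]
  rcases ((hA.abs_eigenvalue_le hR n hv0 hvn hε hv hw hw').2 (abs_of_pos hε)).2 with hs | hs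
  · have := pairing_pos hR n (hs ▸ abs_nonneg _) hw hv0 hv'
    exact this.ne' hz
  · have := pairing_pos hR n (hs ▸ abs_nonneg _) (neg_ne_zero.2 hw) hv0 hv'
    rw [← neg_one_smul ℝ, pairing_smul_left, hz, mul_zero] at this
    exact lt_irrefl _ this

end

end IsPositiveKernel

/-! ### The angular kernel and its two-sided bounds -/

section Sphere

variable {N : ℕ}

open scoped Pointwise in
theorem integral_sphere_neg (φ : Metric.sphere (0 : E N) 1 → ℝ) :
    ∫ w, φ (-w) ∂(volume : Measure (E N)).toSphere =
      ∫ w, φ w ∂(volume : Measure (E N)).toSphere := by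
  have hmp : MeasurePreserving (fun w : Metric.sphere (0 : E N) 1 => -w)
      (volume : Measure (E N)).toSphere (volume : Measure (E N)).toSphere := by
    refine ⟨continuous_neg.measurable, Measure.ext fun s hs => ?_⟩
    rw [Measure.map_apply continuous_neg.measurable hs,
      Measure.toSphere_apply' _ (continuous_neg.measurable hs), Measure.toSphere_apply' _ hs]
    congr 1
    -- The surface measure of a set is defined through the volume of the cone over it, and negation
    -- maps cones to cones.
    have : Ioo (0 : ℝ) 1 • ((↑) '' ((fun w : Metric.sphere (0 : E N) 1 => -w) ⁻¹' s) : Set (E N)) =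
        Neg.neg ⁻¹' (Ioo (0 : ℝ) 1 • ((↑) '' s : Set (E N))) := by
      ext x
      simp only [Set.mem_smul, mem_image, mem_preimage]
      constructor
      · rintro ⟨a, ha, _, ⟨w, hw, rfl⟩, rfl⟩
        exact ⟨a, ha, _, ⟨-w, hw, rfl⟩, by simp⟩
      · rintro ⟨a, ha, _, ⟨w, hw, rfl⟩, h⟩
        exact ⟨a, ha, _, ⟨-w, by simpa using hw, rfl⟩, by simp [h]⟩
    rw [this]
    exact Measure.measure_preimage_neg _ _
  exact hmp.integral_comp (Homeomorph.neg _).measurableEmbedding φ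

theorem integrable_sphere {φ : Metric.sphere (0 : E N) 1 → ℝ} (h : Continuous φ) :
    Integrable φ (volume : Measure (E N)).toSphere :=
  h.integrable_of_hasCompactSupport (HasCompactSupport.of_compactSpace φ)

theorem IsRadial.neg {G : E N → ℝ} (h : IsRadial G) (x : E N) : G (-x) = G x := h _ _ (norm_neg x)

end Sphere

variable {N : ℕ} [NeZero N] {G : E N → ℝ}

theorem norm_e1 : ‖e1 N‖ = 1 := by simp [e1]

theorem IsRadial.eq_profile (h : IsRadial G) (x : E N) : G x = profile G ‖x‖ :=
  h _ _ (by simp [norm_smul, norm_e1])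

theorem IsRadial.profile_neg (h : IsRadial G) (r : ℝ) : profile G (-r) = profile G r := by
  simp only [profile, neg_smul, h.neg]

theorem contDiff_profile {n : WithTop ℕ∞} (h : ContDiff ℝ n G) : ContDiff ℝ n (profile G) :=
  h.comp (contDiff_id.smul contDiff_const)

theorem norm_sub_sq_sphere (r t : ℝ) (w : Metric.sphere (0 : E N) 1) :
    ‖r • e1 N - t • (w : E N)‖ ^ 2 = r ^ 2 + t ^ 2 - 2 * r * t * (w : E N) 0 := by
  rw [norm_sub_sq_real, inner_smul_left, inner_smul_right, norm_smul, norm_smul, norm_e1,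
    norm_eq_of_mem_sphere w, e1, EuclideanSpace.inner_single_left]
  simp
  ring

theorem abs_coord_le (w : Metric.sphere (0 : E N) 1) : |(w : E N) 0| ≤ 1 := by
  have := PiLp.norm_apply_le (w : E N) 0
  rwa [norm_eq_of_mem_sphere w] at this

/-- The kernel `∫ G(r e₁ - t w) w₁ dσ(w)` over the unit sphere. -/
def angularKernel (G : E N → ℝ) (r t : ℝ) : ℝ :=
  ∫ w : Metric.sphere (0 : E N) 1, G (r • e1 N - t • (w : E N)) * (w : E N) 0
    ∂(volume : Measure (E N)).toSphere

theorem continuous_coord : Continuous fun x : E N => x 0 := by fun_prop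

theorem continuous_coord_sphere : Continuous fun w : Metric.sphere (0 : E N) 1 => (w : E N) 0 :=
  continuous_coord.comp continuous_subtype_val

theorem continuous_angularKernel (hG : Continuous G) :
    Continuous fun p : ℝ × ℝ => angularKernel G p.1 p.2 := by
  have h := continuous_parametric_integral_of_continuous
    (μ := (volume : Measure (E N)).toSphere) (s := univ)
    (f := fun (p : ℝ × ℝ) (w : Metric.sphere (0 : E N) 1) =>
      G (p.1 • e1 N - p.2 • (w : E N)) * (w : E N) 0)
    (by unfold Function.uncurry; fun_prop) isCompact_univ
  simp only [Measure.restrict_univ] at h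
  exact h

theorem angularKernel_comm (h : IsRadial G) (r t : ℝ) :
    angularKernel G r t = angularKernel G t r := by
  refine integral_congr_ae (.of_forall fun w => ?_)
  beta_reduce
  congr 1
  refine h _ _ ((sq_eq_sq₀ (norm_nonneg _) (norm_nonneg _)).1 ?_)
  rw [norm_sub_sq_sphere, norm_sub_sq_sphere]
  ring

theorem continuous_sphere_comp (hG : Continuous G) (r t : ℝ) :
    Continuous fun w : Metric.sphere (0 : E N) 1 => G (r • e1 N - t • (w : E N)) :=
  hG.comp (continuous_const.sub (continuous_subtype_val.const_smul t))

/-- Replacing w by -w turns r into -r and changes the sign of w₁. Averaging the two expressions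
exhibits a difference of values of G, from which both bounds on the kernel follow. -/
theorem two_mul_angularKernel (hG : Continuous G) (h : IsRadial G) (r t : ℝ) :
    2 * angularKernel G r t = ∫ w : Metric.sphere (0 : E N) 1,
      (G (r • e1 N - t • (w : E N)) - G ((-r) • e1 N - t • (w : E N))) * (w : E N) 0
        ∂(volume : Measure (E N)).toSphere := by
  have h1 : angularKernel G r t = -∫ w : Metric.sphere (0 : E N) 1,
      G ((-r) • e1 N - t • (w : E N)) * (w : E N) 0 ∂(volume : Measure (E N)).toSphere := by
    rw [angularKernel, ← integral_sphere_neg, ← integral_neg]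
    refine integral_congr_ae (.of_forall fun w => ?_)
    have : r • e1 N - t • ((-w : Metric.sphere (0 : E N) 1) : E N) =
        -((-r) • e1 N - t • (w : E N)) := by
      simp [add_comm]
    beta_reduce
    rw [this, h.neg]
    simp
  rw [two_mul]
  nth_rewrite 2 [h1]
  rw [angularKernel, ← sub_eq_add_neg, ← integral_sub]
  · simp only [sub_mul]
  all_goals exact integrable_sphere ((continuous_sphere_comp hG _ _).mul continuous_coord_sphere)

theorem norm_le_of_mem_Icc {R r t : ℝ} (hr : |r| ≤ R) (ht : |t| ≤ R)
    (w : Metric.sphere (0 : E N) 1) : ‖r • e1 N - t • (w : E N)‖ ≤ 2 * R := by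
  refine (norm_sub_le _ _).trans ?_
  rw [norm_smul, norm_smul, norm_e1, norm_eq_of_mem_sphere w, Real.norm_eq_abs, Real.norm_eq_abs]
  linarith

theorem angularKernel_le (hG : ContDiff ℝ 1 G) (h : IsRadial G) (R : ℝ) :
    ∃ C, ∀ r ∈ Icc 0 R, ∀ t ∈ Icc 0 R, angularKernel G r t ≤ C * r := by
  -- All points r e₁ - t w involved lie in the ball of radius 2R, and the two points compared are at
  -- distance 2r.
  obtain ⟨L, hL⟩ := hG.locallyLipschitz.locallyLipschitzOn (s := Metric.closedBall 0 (2 * R))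
    |>.exists_lipschitzOnWith_of_compact (isCompact_closedBall _ _)
  refine ⟨L * sphereArea N, fun r hr t ht => ?_⟩
  have hpt : ∀ w : Metric.sphere (0 : E N) 1,
      ‖(G (r • e1 N - t • (w : E N)) - G ((-r) • e1 N - t • (w : E N))) * (w : E N) 0‖ ≤
        L * (2 * r) := fun w => by
    have hr' : |r| ≤ R := abs_le.2 ⟨by linarith [hr.1, hr.2], hr.2⟩
    have ht' : |t| ≤ R := abs_le.2 ⟨by linarith [ht.1, ht.2], ht.2⟩
    have h1 := hL.dist_le_mul (r • e1 N - t • (w : E N))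
      (mem_closedBall_zero_iff.2 (norm_le_of_mem_Icc hr' ht' w))
      ((-r) • e1 N - t • (w : E N))
      (mem_closedBall_zero_iff.2 (norm_le_of_mem_Icc (by rwa [abs_neg]) ht' w))
    have h2 : dist (r • e1 N - t • (w : E N)) ((-r) • e1 N - t • (w : E N)) = 2 * r := by
      rw [dist_eq_norm]
      have : r • e1 N - t • (w : E N) - ((-r) • e1 N - t • (w : E N)) = (2 * r) • e1 N := by
        module
      rw [this, norm_smul, norm_e1, mul_one, Real.norm_eq_abs, abs_of_nonneg (by linarith [hr.1])]
    rw [h2] at h1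
    rw [norm_mul, ← dist_eq_norm]
    exact (mul_le_mul h1 (abs_coord_le w) (abs_nonneg _)
      (mul_nonneg L.2 (by linarith [hr.1]))).trans_eq (mul_one _)
  have h1 := norm_integral_le_of_norm_le_const (μ := (volume : Measure (E N)).toSphere)
    (.of_forall hpt)
  rw [← two_mul_angularKernel hG.continuous h, Real.norm_eq_abs] at h1
  have h2 := (le_abs_self _).trans h1
  change _ ≤ L * (2 * r) * sphereArea N at h2
  linarith

theorem IsPotential.antitoneOn_profile_add_sq (hG : IsPotential G) {b : ℝ} (hb : 0 < b) :
    ∃ c > 0, AntitoneOn (fun r => profile G r + c * r ^ 2) (Icc 0 b) := by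
  have hC : ContDiff ℝ 2 (profile G) := contDiff_profile hG.contDiff
  have hC1 : ContDiff ℝ 1 (deriv (profile G)) := hC.deriv'
  have hd : Differentiable ℝ (profile G) := hC.differentiable (by norm_num)
  have hd1 : Differentiable ℝ (deriv (profile G)) := hC1.differentiable (by norm_num)
  have h0 : deriv (profile G) 0 = 0 := by
    have h1 : deriv (fun r => profile G (-r)) 0 = -deriv (profile G) (-0) := deriv_comp_neg _ _
    simp only [hG.radial.profile_neg, neg_zero] at h1
    linarith
  -- The slope function is g'(r)/r, extended by g''(0) at r = 0. It is continuous and negative on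
  -- [0, b], so it has a negative maximum m; then g' ≤ m r, and c = -m/2 works.
  have hcont : ContinuousOn (dslope (deriv (profile G)) 0) (Icc 0 b) := fun r _ => by
    refine ContinuousAt.continuousWithinAt ?_
    rcases eq_or_ne r 0 with rfl | hr
    · exact continuousAt_dslope_same.2 (hd1 0)
    · exact (continuousAt_dslope_of_ne hr).2 (hd1 r).continuousAt
  obtain ⟨x, hx, hmax⟩ := isCompact_Icc.exists_isMaxOn (nonempty_Icc.2 hb.le) hcont
  have hneg : dslope (deriv (profile G)) 0 x < 0 := by
    rcases eq_or_ne x 0 with rfl | hx0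
    · rw [dslope_same]
      have := hG.deriv2_neg
      rwa [iteratedDeriv_succ, iteratedDeriv_one] at this
    · have hxp : 0 < x := lt_of_le_of_ne hx.1 hx0.symm
      rw [dslope_of_ne _ hx0, slope_def_field, h0, sub_zero, sub_zero]
      exact div_neg_of_neg_of_pos (hG.deriv_neg x hxp) hxp
  set m := dslope (deriv (profile G)) 0 x
  refine ⟨-m / 2, by linarith, antitoneOn_of_deriv_nonpos (convex_Icc 0 b)
    (hd.continuous.add (by fun_prop)).continuousOn
    (hd.add (by fun_prop)).differentiableOn fun r hr => ?_⟩
  rw [interior_Icc] at hr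
  have h1 : HasDerivAt (fun r => profile G r + -m / 2 * r ^ 2)
      (deriv (profile G) r + -m / 2 * (2 * r)) r := by
    have := (hd r).hasDerivAt.add ((hasDerivAt_pow 2 r).const_mul (-m / 2))
    simp only [Nat.cast_ofNat, Nat.add_one_sub_one, pow_one] at this
    exact this
  rw [h1.deriv]
  have h2 : dslope (deriv (profile G)) 0 r ≤ m := hmax ⟨hr.1.le, hr.2.le⟩
  rw [dslope_of_ne _ hr.1.ne', slope_def_field, h0, sub_zero, sub_zero, div_le_iff₀ hr.1] at h2
  linarith

theorem integral_coord_sq_pos : 0 < ∫ w : Metric.sphere (0 : E N) 1, (w : E N) 0 ^ 2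
    ∂(volume : Measure (E N)).toSphere := by
  refine Continuous.integral_pos_of_hasCompactSupport_nonneg_nonzero
    (continuous_coord_sphere.pow 2) (HasCompactSupport.of_compactSpace _)
    (fun w => sq_nonneg _) (x := ⟨e1 N, by simp [norm_e1]⟩) ?_
  simp [e1]

theorem IsPotential.le_angularKernel (hG : IsPotential G) {R : ℝ} (hR : 0 < R) :
    ∃ c > 0, ∀ r ∈ Icc 0 R, ∀ t ∈ Icc 0 R, c * r * t ≤ angularKernel G r t := by
  obtain ⟨c, hc, hanti⟩ := hG.antitoneOn_profile_add_sq (b := 2 * R) (by linarith)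
  refine ⟨2 * c * ∫ w : Metric.sphere (0 : E N) 1, (w : E N) 0 ^ 2
    ∂(volume : Measure (E N)).toSphere, mul_pos (by linarith) integral_coord_sq_pos,
    fun r hr t ht => ?_⟩
  have hr' : |r| ≤ R := abs_le.2 ⟨by linarith [hr.1, hr.2], hr.2⟩
  have ht' : |t| ≤ R := abs_le.2 ⟨by linarith [ht.1, ht.2], ht.2⟩
  have hpt : ∀ w : Metric.sphere (0 : E N) 1, 4 * c * r * t * (w : E N) 0 ^ 2 ≤
      (G (r • e1 N - t • (w : E N)) - G ((-r) • e1 N - t • (w : E N))) * (w : E N) 0 := fun w => by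
    have hp := norm_sub_sq_sphere r t w
    have hq := norm_sub_sq_sphere (-r) t w
    have hp2 := norm_le_of_mem_Icc hr' ht' w
    have hq2 := norm_le_of_mem_Icc (r := -r) (by rwa [abs_neg]) ht' w
    rw [hG.radial.eq_profile (r • e1 N - t • (w : E N)),
      hG.radial.eq_profile ((-r) • e1 N - t • (w : E N))]
    set p := ‖r • e1 N - t • (w : E N)‖
    set q := ‖(-r) • e1 N - t • (w : E N)‖
    have hp0 : 0 ≤ p := norm_nonneg _
    have hq0 : 0 ≤ q := norm_nonneg _
    have hrt : 0 ≤ r * t := mul_nonneg hr.1 ht.1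
    -- With p and q the two distances, monotonicity of g + c r² compares g(p) - g(q) with c (q² -
    -- p²) = 4 c r t w₁. Multiplying by w₁, whose sign decides which distance is larger, gives a
    -- square.
    have hqp : q ^ 2 - p ^ 2 = 4 * (r * t) * (w : E N) 0 := by rw [hp, hq]; ring
    have hfin : 4 * c * r * t * (w : E N) 0 ^ 2 = c * (q ^ 2 - p ^ 2) * (w : E N) 0 := by
      rw [hqp]; ring
    rw [hfin]
    rcases le_total 0 ((w : E N) 0) with hw | hw
    · have hle : p ≤ q := (sq_le_sq₀ hp0 hq0).1 (by nlinarith)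
      have := hanti ⟨hp0, hp2⟩ ⟨hq0, hq2⟩ hle
      exact mul_le_mul_of_nonneg_right (by linarith) hw
    · have hle : q ≤ p := (sq_le_sq₀ hq0 hp0).1 (by nlinarith)
      have := hanti ⟨hq0, hq2⟩ ⟨hp0, hp2⟩ hle
      exact mul_le_mul_of_nonpos_right (by linarith) hw
  have h1 := integral_mono (μ := (volume : Measure (E N)).toSphere)
    (f := fun w => 4 * c * r * t * (w : E N) 0 ^ 2)
    (g := fun w => (G (r • e1 N - t • (w : E N)) - G ((-r) • e1 N - t • (w : E N))) * (w : E N) 0)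
    (integrable_sphere ((continuous_coord_sphere.pow 2).const_mul (4 * c * r * t)))
    (integrable_sphere (((continuous_sphere_comp hG.continuous r t).sub
      (continuous_sphere_comp hG.continuous (-r) t)).mul continuous_coord_sphere)) hpt
  rw [← two_mul_angularKernel hG.continuous hG.radial, integral_const_mul] at h1
  linarith

theorem IsPotential.isPositiveKernel (hG : IsPotential G) {R : ℝ} (hR : 0 < R) :
    IsPositiveKernel R (angularKernel G) where
  continuous := continuous_angularKernel hG.continuous
  symm := angularKernel_comm hG.radial
  lower := hG.le_angularKernel hR
  upper := angularKernel_le (hG.contDiff.of_le (by norm_num)) hG.radial R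

/-! ### Polar coordinates -/

section Polar

variable {N : ℕ} [NeZero N]

/-- Integration in polar coordinates. -/
theorem integral_eq_integral_sphereIntegral {Φ : E N → ℝ} (hΦ : Integrable Φ) :
    ∫ x, Φ x = ∫ s in Ioi (0 : ℝ), sphereIntegral s Φ := by
  let μ : Measure (E N) := volume
  have hdim : Module.finrank ℝ (E N) - 1 = N - 1 := by simp
  have hmp := μ.measurePreserving_homeomorphUnitSphereProd
  rw [hdim] at hmp
  let Ψ : Metric.sphere (0 : E N) 1 × Ioi (0 : ℝ) → ℝ := fun p => Φ ((p.2 : ℝ) • (p.1 : E N))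
  have hcomp : ∀ x : ({0}ᶜ : Set (E N)), Ψ (homeomorphUnitSphereProd (E N) x) = Φ x := fun x => by
    have h := congrArg Subtype.val ((homeomorphUnitSphereProd (E N)).symm_apply_apply x)
    rw [homeomorphUnitSphereProd_symm_apply_coe] at h
    exact congrArg Φ h
  have hint : Integrable Ψ (μ.toSphere.prod (Measure.volumeIoiPow (N - 1))) := by
    rw [← hmp.integrable_comp_emb (Homeomorph.measurableEmbedding _)]
    have h1 : Integrable (fun x : ({0}ᶜ : Set (E N)) => Φ x) (μ.comap (↑)) :=
      (integrableOn_iff_comap_subtypeVal (measurableSet_singleton 0).compl).1 hΦ.integrableOn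
    exact h1.congr (.of_forall fun x => (hcomp x).symm)
  calc ∫ x, Φ x = ∫ x : ({0}ᶜ : Set (E N)), Φ x ∂(μ.comap (↑)) := by
        rw [integral_subtype_comap (measurableSet_singleton _).compl Φ, restrict_compl_singleton]
    _ = ∫ p, Ψ p ∂μ.toSphere.prod (Measure.volumeIoiPow (N - 1)) := by
        rw [← hmp.integral_comp (Homeomorph.measurableEmbedding _)]
        exact integral_congr_ae (.of_forall fun x => (hcomp x).symm)
    _ = ∫ s : Ioi (0 : ℝ), ∫ w, Φ ((s : ℝ) • (w : E N)) ∂μ.toSphere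
          ∂Measure.volumeIoiPow (N - 1) := integral_prod_symm Ψ hint
    _ = ∫ s in Ioi (0 : ℝ), sphereIntegral s Φ := by
        -- The radial measure has density s^(N-1), which is the factor built into `sphereIntegral`.
        simp only [Measure.volumeIoiPow, ENNReal.ofReal]
        rw [integral_withDensity_eq_integral_smul
            ((measurable_subtype_coe.pow_const _).real_toNNReal),
          ← integral_subtype_comap measurableSet_Ioi fun s => sphereIntegral s Φ]
        refine integral_congr_ae (.of_forall fun s => ?_)
        beta_reduce
        rw [NNReal.smul_def, Real.coe_toNNReal _ (pow_nonneg s.2.out.le _)]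
        rfl

theorem integral_eq_intervalIntegral_sphereIntegral {Φ : E N → ℝ} (hΦ : Integrable Φ) {R : ℝ}
    (hR : 0 ≤ R) (h : ∀ x, R < ‖x‖ → Φ x = 0) :
    ∫ x, Φ x = ∫ s in (0 : ℝ)..R, sphereIntegral s Φ := by
  rw [integral_eq_integral_sphereIntegral hΦ, intervalIntegral.integral_of_le hR]
  refine setIntegral_eq_of_subset_of_forall_sdiff_eq_zero measurableSet_Ioi Ioc_subset_Ioi_self
    fun s hs => ?_
  have hsR : R < s := not_le.1 fun h' => hs.2 ⟨hs.1, h'⟩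
  have h0 : ∀ w : Metric.sphere (0 : E N) 1, Φ (s • (w : E N)) = 0 := fun w => h _ (by
    rwa [norm_smul, norm_eq_of_mem_sphere w, mul_one, Real.norm_eq_abs, abs_of_pos hs.1])
  simp [sphereIntegral, h0]

end Polar

/-! ### Radial extensions and their convolution with G -/

section RadialExt

variable {N : ℕ} {R : ℝ} (hR : 0 ≤ R)

/-- The radial function on `ℝ^N` with representative `f` on `[0, R]`, constant beyond `R`. -/
def radialExt (N : ℕ) {R : ℝ} (hR : 0 ≤ R) (f : C(Icc (0 : ℝ) R, ℝ)) (x : E N) : ℝ :=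
  IccExtend hR f ‖x‖

theorem continuous_radialExt (f : C(Icc (0 : ℝ) R, ℝ)) : Continuous (radialExt N hR f) :=
  (continuous_IccExtend hR f).comp continuous_norm

theorem isRadial_radialExt (f : C(Icc (0 : ℝ) R, ℝ)) : IsRadial (radialExt N hR f) :=
  fun x y h => by rw [radialExt, radialExt, h]

theorem IccExtend_eq_zero {f : C(Icc (0 : ℝ) R, ℝ)} (hf : f ∈ Y R) {s : ℝ} (hs : R ≤ s) :
    IccExtend hR f s = 0 := by
  rw [IccExtend_of_right_le hR f hs]
  exact hf _ rfl

theorem radialExt_eq_zero {f : C(Icc (0 : ℝ) R, ℝ)} (hf : f ∈ Y R) {x : E N} (hx : R ≤ ‖x‖) :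
    radialExt N hR f x = 0 := IccExtend_eq_zero hR hf hx

theorem hasCompactSupport_radialExt {f : C(Icc (0 : ℝ) R, ℝ)} (hf : f ∈ Y R) :
    HasCompactSupport (radialExt N hR f) :=
  HasCompactSupport.intro (isCompact_closedBall 0 R) fun x hx =>
    radialExt_eq_zero hR hf (by
      rw [mem_closedBall_zero_iff, not_le] at hx
      exact hx.le)

theorem integrable_radialExt {f : C(Icc (0 : ℝ) R, ℝ)} (hf : f ∈ Y R) :
    Integrable (radialExt N hR f) :=
  (continuous_radialExt hR f).integrable_of_hasCompactSupport (hasCompactSupport_radialExt hR hf)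

theorem profile_radialExt [NeZero N] (f : C(Icc (0 : ℝ) R, ℝ)) {r : ℝ} (hr : 0 ≤ r) :
    profile (radialExt N hR f) r = IccExtend hR f r := by
  rw [profile, radialExt, norm_smul, norm_e1, mul_one, Real.norm_eq_abs, abs_of_nonneg hr]

theorem radialExt_smul_sphere (f : C(Icc (0 : ℝ) R, ℝ)) {s : ℝ} (hs : 0 ≤ s)
    (w : Metric.sphere (0 : E N) 1) :
    radialExt N hR f (s • (w : E N)) = IccExtend hR f s := by
  rw [radialExt, norm_smul, norm_eq_of_mem_sphere w, mul_one, Real.norm_eq_abs, abs_of_nonneg hs]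

theorem integral_radialExt [NeZero N] (f : Y R) :
    ∫ x, radialExt N hR f x = radialMass N hR f := by
  rw [integral_eq_intervalIntegral_sphereIntegral (integrable_radialExt hR f.2) hR
    fun x hx => radialExt_eq_zero hR f.2 hx.le]
  refine intervalIntegral.integral_congr fun s hs => ?_
  rw [uIcc_of_le hR] at hs
  simp only [sphereIntegral, radialExt_smul_sphere hR _ hs.1, integral_const, smul_eq_mul,
    sphereArea]
  ring

end RadialExt

section Conv

variable {N : ℕ} {G F : E N → ℝ} {R : ℝ}

theorem conv_apply (x : E N) : conv G F x = ∫ y, G y * F (x - y) := rfl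

theorem conv_apply' (x : E N) : conv G F x = ∫ y, G (x - y) * F y := convolution_eq_swap _

theorem isRadial_conv (hG : IsRadial G) (hF : IsRadial F) : IsRadial (conv G F) := by
  intro x y hxy
  -- The reflection exchanging x and y preserves volume and norms.
  let e := Submodule.reflection (ℝ ∙ (x - y))ᗮ
  have he : e x = y := Submodule.reflection_sub hxy
  symm
  rw [conv_apply, conv_apply, ← e.measurePreserving.integral_comp e.toHomeomorph.measurableEmbedding]
  refine integral_congr_ae (.of_forall fun z => ?_)
  beta_reduce
  congr 1
  · exact hG _ _ (e.norm_map z)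
  · refine hF _ _ ?_
    rw [← he, ← map_sub, e.norm_map]

/-- G need not have compact support, so it is cut off by a bump equal to 1 on the ball of radius 3R.
For |x| < 2R and |y| ≤ R one has |x - y| ≤ 3R, so the convolution is unchanged there. -/
theorem contDiffOn_conv {n : ℕ∞} (hG : ContDiff ℝ n G) (hF : Continuous F) (hR : 0 < R)
    (hsupp : ∀ x, R < ‖x‖ → F x = 0) :
    ContDiffOn ℝ n (conv G F) (Metric.ball 0 (2 * R)) := by
  let χ : ContDiffBump (0 : E N) := ⟨3 * R, 4 * R, by linarith, by linarith⟩
  have hc : HasCompactSupport fun x => χ x * G x := χ.hasCompactSupport.mul_right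
  have h : ContDiff ℝ n (conv (fun x => χ x * G x) F) :=
    hc.contDiff_convolution_left _ (χ.contDiff.mul hG) hF.locallyIntegrable
  refine h.contDiffOn.congr fun x hx => ?_
  rw [mem_ball_zero_iff] at hx
  rw [conv_apply', conv_apply']
  refine integral_congr_ae (.of_forall fun y => ?_)
  beta_reduce
  rcases lt_or_ge R ‖y‖ with hy | hy
  · simp [hsupp y hy]
  · rw [χ.one_of_mem_closedBall, one_mul]
    rw [mem_closedBall_zero_iff]
    change ‖x - y‖ ≤ 3 * R
    linarith [norm_sub_le x y]

theorem integrable_conv_integrand (hG : Continuous G) (hR : 0 ≤ R) (f : Y R) (x : E N) :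
    Integrable fun y => G (x - y) * radialExt N hR f y :=
  ((hG.comp (continuous_const.sub continuous_id)).mul
    (continuous_radialExt hR _)).integrable_of_hasCompactSupport
    (hasCompactSupport_radialExt hR f.2).mul_left

variable [NeZero N]

theorem profile_conv_radialExt (hG : Continuous G) (hR : 0 ≤ R) (f : Y R) (r : ℝ) :
    profile (conv G (radialExt N hR f)) r = ∫ s in (0 : ℝ)..R,
      sphereIntegral s (fun y => G (r • e1 N - y)) * IccExtend hR (f : C(Icc (0 : ℝ) R, ℝ)) s := by
  rw [profile, conv_apply', integral_eq_intervalIntegral_sphereIntegral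
    (integrable_conv_integrand hG hR f _) hR fun x hx => by
      rw [radialExt_eq_zero hR f.2 hx.le, mul_zero]]
  refine intervalIntegral.integral_congr fun s hs => ?_
  rw [uIcc_of_le hR] at hs
  simp only [sphereIntegral, radialExt_smul_sphere hR _ hs.1]
  rw [integral_mul_const]
  ring

theorem continuous_sphereIntegral (hG : Continuous G) (r : ℝ) :
    Continuous fun s => sphereIntegral s fun y => G (r • e1 N - y) := by
  have h := continuous_parametric_integral_of_continuous
    (μ := (volume : Measure (E N)).toSphere) (s := univ)
    (f := fun (s : ℝ) (w : Metric.sphere (0 : E N) 1) => G (r • e1 N - s • (w : E N)))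
    (by unfold Function.uncurry; fun_prop) isCompact_univ
  simp only [Measure.restrict_univ] at h
  exact (continuous_id.pow _).mul h

theorem kernel_eq_sub (hG : Continuous G) (r s : ℝ) :
    kernel G R r s = sphereIntegral s (fun y => G (r • e1 N - y)) -
      sphereIntegral s (fun y => G (R • e1 N - y)) := by
  rw [kernel, sphereIntegral, sphereIntegral, sphereIntegral, ← mul_sub, ← integral_sub]
  all_goals exact integrable_sphere (continuous_sphere_comp hG _ _)

theorem opG_apply (hG : Continuous G) (hR : 0 ≤ R) (f : Y R) (r : Icc (0 : ℝ) R) :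
    (opG hG hR f : C(Icc (0 : ℝ) R, ℝ)) r = profile (conv G (radialExt N hR f)) r -
      profile (conv G (radialExt N hR f)) R := by
  rw [profile_conv_radialExt hG, profile_conv_radialExt hG, ← intervalIntegral.integral_sub]
  · refine intervalIntegral.integral_congr fun s _ => ?_
    simp only [kernel_eq_sub hG, sub_mul]
  all_goals exact ((continuous_sphereIntegral hG _).mul
    (continuous_IccExtend hR _)).intervalIntegrable _ _

end Conv

/-! ### Primitives vanishing at R -/

section Primitive

variable {R : ℝ} (hR : 0 ≤ R)

/-- The primitive `r ↦ ∫_r^R u` vanishing at `R`. -/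
def primitive {R : ℝ} (hR : 0 ≤ R) (u : C(Icc (0 : ℝ) R, ℝ)) : Y R :=
  ⟨⟨fun r => ∫ s in (r : ℝ)..R, IccExtend hR u s, by
      have h : Continuous fun r : ℝ => ∫ s in R..r, IccExtend hR u s :=
        intervalIntegral.continuous_primitive
          (fun a b => (continuous_IccExtend hR u).intervalIntegrable a b) R
      simp only [intervalIntegral.integral_symm R]
      exact (h.comp continuous_subtype_val).neg⟩,
    fun r hr => by simp [hr]⟩

theorem primitive_apply (u : C(Icc (0 : ℝ) R, ℝ)) (r : Icc (0 : ℝ) R) :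
    (primitive hR u : C(Icc (0 : ℝ) R, ℝ)) r = ∫ s in (r : ℝ)..R, IccExtend hR u s := rfl

theorem IccExtend_primitive (u : C(Icc (0 : ℝ) R, ℝ)) {r : ℝ} (hr : r ∈ Icc 0 R) :
    IccExtend hR (primitive hR u : C(Icc (0 : ℝ) R, ℝ)) r = ∫ s in r..R, IccExtend hR u s := by
  rw [IccExtend_of_mem hR _ hr, primitive_apply]

theorem hasDerivAt_integral_Icc (u : C(Icc (0 : ℝ) R, ℝ)) (r : ℝ) :
    HasDerivAt (fun r => ∫ s in r..R, IccExtend hR u s) (-IccExtend hR u r) r := by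
  have hc := continuous_IccExtend hR u
  exact intervalIntegral.integral_hasDerivAt_left (hc.intervalIntegrable _ _)
    (hc.stronglyMeasurableAtFilter _ _) hc.continuousAt

theorem hasDerivAt_IccExtend_primitive (u : C(Icc (0 : ℝ) R, ℝ)) {r : ℝ} (hr : r ∈ Ioo 0 R) :
    HasDerivAt (IccExtend hR (primitive hR u : C(Icc (0 : ℝ) R, ℝ))) (-IccExtend hR u r) r :=
  (hasDerivAt_integral_Icc hR u r).congr_of_eventuallyEq <| by
    filter_upwards [Icc_mem_nhds hr.1 hr.2] with s hs using IccExtend_primitive hR u hs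

theorem lipschitzWith_IccExtend_primitive (u : C(Icc (0 : ℝ) R, ℝ)) :
    LipschitzWith ‖u‖₊ (IccExtend hR (primitive hR u : C(Icc (0 : ℝ) R, ℝ))) := by
  have hc := continuous_IccExtend hR u
  have h1 : LipschitzWith ‖u‖₊ (primitive hR u : C(Icc (0 : ℝ) R, ℝ)) := by
    refine LipschitzWith.of_dist_le_mul fun x y => ?_
    have h := intervalIntegral.integral_add_adjacent_intervals
      (hc.intervalIntegrable (μ := volume) x y) (hc.intervalIntegrable y R)
    rw [Real.dist_eq, primitive_apply, primitive_apply, ← h, add_sub_cancel_right,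
      ← Real.norm_eq_abs, Subtype.dist_eq, Real.dist_eq, abs_sub_comm]
    exact intervalIntegral.norm_integral_le_of_norm_le_const (C := ‖u‖)
      fun s _ => abs_IccExtend_le hR u s
  have h2 := h1.comp (LipschitzWith.projIcc hR)
  rwa [mul_one] at h2

end Primitive

/-! ### The radial derivative of the convolution -/

section Derivative

variable {N : ℕ} [NeZero N] {G : E N → ℝ} {R : ℝ}

theorem hasDerivAt_norm_smul_e1_sub (r : ℝ) (y : E N) (h : r • e1 N - y ≠ 0) :
    HasDerivAt (fun r : ℝ => ‖r • e1 N - y‖) ((r • e1 N - y) 0 / ‖r • e1 N - y‖) r := by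
  have h1 : HasDerivAt (fun r : ℝ => r • e1 N - y) (e1 N) r := by
    simpa using ((hasDerivAt_id r).smul_const (e1 N)).sub_const y
  have h2 := h1.norm_sq.sqrt (by simpa using h)
  simp only [Real.sqrt_sq (norm_nonneg _)] at h2
  convert! h2 using 1
  rw [e1, EuclideanSpace.inner_single_right]
  simp
  field_simp

/-- The directional derivative along `e₁`, almost everywhere, of a radial function whose
representative has derivative `-u` on `(0, R)` and vanishes beyond `R`. -/
def radialDeriv (hR : 0 ≤ R) (u : C(Icc (0 : ℝ) R, ℝ)) : E N → ℝ :=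
  (Metric.closedBall 0 R).indicator fun z => IccExtend hR u ‖z‖ * (z 0 / ‖z‖)

theorem measurable_radialDeriv (hR : 0 ≤ R) (u : C(Icc (0 : ℝ) R, ℝ)) :
    Measurable (radialDeriv (N := N) hR u) :=
  (((continuous_IccExtend hR u).comp continuous_norm).measurable.mul
    (Measurable.div (G := ℝ) (α := E N) (f := fun z => z 0) continuous_coord.measurable
      measurable_norm)).indicator measurableSet_closedBall

theorem hasDerivAt_radialExt_primitive (hR : 0 ≤ R) (u : C(Icc (0 : ℝ) R, ℝ)) (r : ℝ) (y : E N)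
    (h0 : ‖r • e1 N - y‖ ≠ 0) (h1 : ‖r • e1 N - y‖ ≠ R) :
    HasDerivAt (fun r : ℝ => radialExt N hR (primitive hR u) (r • e1 N - y))
      (-radialDeriv hR u (r • e1 N - y)) r := by
  have hn := hasDerivAt_norm_smul_e1_sub r y (norm_ne_zero_iff.1 h0)
  rcases lt_or_gt_of_ne h1 with hlt | hgt
  · rw [radialDeriv, indicator_of_mem (mem_closedBall_zero_iff.2 hlt.le), ← neg_mul]
    exact (hasDerivAt_IccExtend_primitive hR u
      ⟨lt_of_le_of_ne (norm_nonneg _) h0.symm, hlt⟩).comp r hn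
  · rw [radialDeriv, indicator_of_notMem (by simpa using hgt), neg_zero]
    refine (hasDerivAt_const r (0 : ℝ)).congr_of_eventuallyEq ?_
    filter_upwards [hn.continuousAt.eventually (lt_mem_nhds hgt)] with s hs
    exact radialExt_eq_zero hR (primitive hR u).2 (le_of_lt hs)

theorem lipschitzWith_radialExt_primitive (hR : 0 ≤ R) (u : C(Icc (0 : ℝ) R, ℝ)) (y : E N) :
    LipschitzWith ‖u‖₊ fun r : ℝ => radialExt N hR (primitive hR u) (r • e1 N - y) := by
  have h : LipschitzWith 1 fun r : ℝ => ‖r • e1 N - y‖ := by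
    refine LipschitzWith.of_dist_le_mul fun r s => ?_
    rw [NNReal.coe_one, one_mul, Real.dist_eq, Real.dist_eq]
    refine (abs_norm_sub_norm_le _ _).trans_eq ?_
    rw [sub_sub_sub_cancel_right, ← sub_smul, norm_smul, norm_e1, mul_one, Real.norm_eq_abs]
  have := (lipschitzWith_IccExtend_primitive hR u).comp h
  rwa [mul_one] at this

/-- Differentiation of `G * F` for radial `F` moves the derivative to the representative of `F`. -/
theorem hasDerivAt_profile_conv_primitive (hG : Continuous G) (hGi : Integrable G) (hR : 0 ≤ R)
    (u : C(Icc (0 : ℝ) R, ℝ)) (r : ℝ) :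
    HasDerivAt (profile (conv G (radialExt N hR (primitive hR u))))
      (-∫ s in (0 : ℝ)..R, s ^ (N - 1) * angularKernel G r s * IccExtend hR u s) r := by
  have hcF : Continuous (radialExt N hR (primitive hR u)) := continuous_radialExt hR _
  -- The radial function is Lipschitz but may fail to be differentiable at the origin and on the
  -- sphere of radius R. Both are null sets, which dominated differentiation tolerates.
  have hsph : ∀ a : ℝ, ∀ᵐ y : E N, ‖r • e1 N - y‖ ≠ a := fun a => by
    have h : volume (Metric.sphere (r • e1 N) a) = 0 := Measure.addHaar_sphere _ _ _
    filter_upwards [compl_mem_ae_iff.2 h] with y hy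
    rwa [mem_compl_iff, mem_sphere_iff_norm, norm_sub_rev] at hy
  have hmeas : ∀ s : ℝ, AEStronglyMeasurable
      (fun y => G y * radialExt N hR (primitive hR u) (s • e1 N - y)) volume := fun s =>
    (hG.mul (hcF.comp (continuous_const.sub continuous_id))).aestronglyMeasurable
  obtain ⟨M, hM⟩ := hcF.bounded_above_of_compact_support
    (hasCompactSupport_radialExt hR (primitive hR u).2)
  have hmain := hasDerivAt_integral_of_dominated_loc_of_lip (μ := (volume : Measure (E N)))
    (F := fun s y => G y * radialExt N hR (primitive hR u) (s • e1 N - y))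
    (F' := fun y => G y * -radialDeriv hR u (r • e1 N - y)) (x₀ := r) (s := univ)
    (bound := fun y => ‖u‖ * G y) univ_mem (.of_forall hmeas)
    (hGi.mul_bdd (c := M) (hcF.comp (continuous_const.sub continuous_id)).aestronglyMeasurable
      (.of_forall fun y => hM _))
    (hG.measurable.mul ((measurable_radialDeriv hR u).comp
      (measurable_const.sub measurable_id)).neg).aestronglyMeasurable
    (.of_forall fun y => by
      refine (LipschitzWith.of_dist_le_mul fun a b => ?_).lipschitzOnWith
      rw [Real.dist_eq, ← mul_sub, abs_mul, Real.coe_nnabs, abs_mul, abs_norm, mul_comm ‖u‖,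
        mul_assoc]
      exact mul_le_mul_of_nonneg_left
        ((lipschitzWith_radialExt_primitive hR u y).dist_le_mul a b) (abs_nonneg _))
    (hGi.const_mul _)
    (by
      filter_upwards [hsph 0, hsph R] with y h0 h1
      exact (hasDerivAt_radialExt_primitive hR u r y h0 h1).const_mul (G y))
  obtain ⟨hint, hderiv⟩ := hmain
  have hint' : Integrable fun z => G (r • e1 N - z) * radialDeriv hR u z := by
    have := (hint.comp_sub_left (r • e1 N)).neg
    refine this.congr (.of_forall fun z => ?_)
    simp
  have hval : ∫ y, G y * -radialDeriv hR u (r • e1 N - y) =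
      -∫ s in (0 : ℝ)..R, s ^ (N - 1) * angularKernel G r s * IccExtend hR u s := by
    -- The substitution z = r e₁ - y moves the shift back onto G, after which polar coordinates in z
    -- apply.
    rw [← integral_sub_left_eq_self _ volume (r • e1 N)]
    simp only [sub_sub_cancel, mul_neg, integral_neg]
    rw [integral_eq_intervalIntegral_sphereIntegral hint' hR fun x hx => by
      rw [radialDeriv, indicator_of_notMem (by simpa using hx), mul_zero]]
    congr 1
    -- Working on (0, R] avoids s = 0, where z₁/|z| = w₁ fails.
    refine intervalIntegral.integral_congr_ae (.of_forall fun s hs => ?_)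
    rw [uIoc_of_le hR] at hs
    rw [sphereIntegral, mul_assoc, angularKernel, ← integral_mul_const]
    congr 1
    refine integral_congr_ae (.of_forall fun w => ?_)
    have hn : ‖s • (w : E N)‖ = s := by
      rw [norm_smul, norm_eq_of_mem_sphere w, mul_one, Real.norm_eq_abs, abs_of_pos hs.1]
    beta_reduce
    rw [radialDeriv, indicator_of_mem (by rw [mem_closedBall_zero_iff, hn]; exact hs.2), hn,
      PiLp.smul_apply, smul_eq_mul, mul_div_cancel_left₀ _ hs.1.ne']
    ring
  rw [← hval]
  exact hderiv

end Derivative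

/-! ### Derivatives, injectivity and mass of primitives -/

section Primitive

variable {R : ℝ} (hR : 0 < R)

theorem primitive_smul (a : ℝ) (u : C(Icc (0 : ℝ) R, ℝ)) :
    primitive hR.le (a • u) = a • primitive hR.le u := by
  ext r
  change ∫ s in (r : ℝ)..R, a * IccExtend hR.le u s = a * ∫ s in (r : ℝ)..R, IccExtend hR.le u s
  exact intervalIntegral.integral_const_mul _ _

theorem hasDerivWithinAt_primitive {u : C(Icc (0 : ℝ) R, ℝ)} {g : ℝ → ℝ}
    (hg : ∀ r : Icc (0 : ℝ) R, g r = (primitive hR.le u : C(Icc (0 : ℝ) R, ℝ)) r)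
    (r : Icc (0 : ℝ) R) : HasDerivWithinAt g (-u r) (Icc 0 R) r := by
  have h := (hasDerivAt_integral_Icc hR.le u r).hasDerivWithinAt (s := Icc 0 R)
  rw [IccExtend_coe] at h
  exact h.congr (fun s hs => hg ⟨s, hs⟩) (hg r)

theorem derivWithin_primitive {u : C(Icc (0 : ℝ) R, ℝ)} {g : ℝ → ℝ}
    (hg : ∀ r : Icc (0 : ℝ) R, g r = (primitive hR.le u : C(Icc (0 : ℝ) R, ℝ)) r)
    (r : Icc (0 : ℝ) R) : derivWithin g (Icc 0 R) r = -u r :=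
  (hasDerivWithinAt_primitive hR hg r).derivWithin (uniqueDiffOn_Icc hR r r.2)

theorem primitive_injective : Function.Injective (primitive hR.le) := by
  intro u w h
  ext r
  have hg : ∀ r : Icc (0 : ℝ) R, IccExtend hR.le (primitive hR.le u : C(Icc (0 : ℝ) R, ℝ)) r =
      (primitive hR.le u : C(Icc (0 : ℝ) R, ℝ)) r := fun r => IccExtend_coe _ _ r
  have h1 := derivWithin_primitive hR hg r
  rw [derivWithin_primitive hR (u := w) (by rw [← h]; exact hg) r] at h1
  exact (neg_injective h1).symm

theorem primitive_pos {v : C(Icc (0 : ℝ) R, ℝ)} (hv0 : 0 ≤ v)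
    (hv : ∀ t : Icc (0 : ℝ) R, 0 < (t : ℝ) → 0 < v t) (r : Icc (0 : ℝ) R) (hr : (r : ℝ) < R) :
    0 < (primitive hR.le v : C(Icc (0 : ℝ) R, ℝ)) r := by
  refine intervalIntegral.integral_pos hr (continuous_IccExtend hR.le v).continuousOn
    (fun t _ => ContinuousMap.le_def.1 hv0 _) ⟨R, ⟨hr.le, le_rfl⟩, ?_⟩
  rw [IccExtend_right]
  exact hv _ hR

theorem primitive_nonneg {v : C(Icc (0 : ℝ) R, ℝ)} (hv0 : 0 ≤ v) (r : Icc (0 : ℝ) R) :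
    0 ≤ (primitive hR.le v : C(Icc (0 : ℝ) R, ℝ)) r :=
  intervalIntegral.integral_nonneg r.2.2 fun _ _ => ContinuousMap.le_def.1 hv0 _

end Primitive

section RadialMass

variable {N : ℕ} {R : ℝ} (hR : 0 < R)

theorem radialMass_smul (a : ℝ) (f : Y R) :
    radialMass N hR.le (a • f) = a * radialMass N hR.le f := by
  rw [radialMass, radialMass, ← intervalIntegral.integral_const_mul]
  refine intervalIntegral.integral_congr fun r _ => ?_
  simp [IccExtend]
  ring

theorem sphereArea_pos [NeZero N] : 0 < sphereArea N := by
  rw [sphereArea, measureReal_def, ENNReal.toReal_pos_iff]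
  exact ⟨Measure.measure_univ_pos.2 (Measure.toSphere_ne_zero _), measure_lt_top _ _⟩

theorem radialMass_primitive_pos [NeZero N] {v : C(Icc (0 : ℝ) R, ℝ)} (hv0 : 0 ≤ v)
    (hv : ∀ t : Icc (0 : ℝ) R, 0 < (t : ℝ) → 0 < v t) :
    0 < radialMass N hR.le (primitive hR.le v) := by
  have hω := sphereArea_pos (N := N)
  refine intervalIntegral.integral_pos hR
    (((continuous_IccExtend hR.le _).mul continuous_const).mul
      (continuous_id.pow _)).continuousOn
    (fun r hr => mul_nonneg (mul_nonneg (primitive_nonneg hR hv0 _) hω.le)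
      (pow_nonneg hr.1.le _)) ⟨R / 2, ⟨by linarith, by linarith⟩, ?_⟩
  rw [IccExtend_of_mem hR.le _ (⟨by linarith, by linarith⟩ : R / 2 ∈ Icc 0 R)]
  exact mul_pos (mul_pos (primitive_pos hR hv0 hv _ (by simp; linarith)) hω)
    (pow_pos (by linarith) _)

end RadialMass

/-! ### Intertwining of the two operators -/

variable {N : ℕ} [NeZero N] {G : E N → ℝ} {R : ℝ} (hG : IsPotential G) (hR : 0 < R)

/-- The operator governing the derivatives of the eigenfunctions of `opG`. -/
abbrev derivOp : C(Icc (0 : ℝ) R, ℝ) →ₗ[ℝ] C(Icc (0 : ℝ) R, ℝ) :=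
  (hG.isPositiveKernel hR).op hR (N - 1)

theorem hasDerivAt_profile_conv (u : C(Icc (0 : ℝ) R, ℝ)) (r : Icc (0 : ℝ) R) :
    HasDerivAt (profile (conv G (radialExt N hR.le (primitive hR.le u))))
      (-derivOp hG hR u r) r :=
  hasDerivAt_profile_conv_primitive hG.continuous hG.integrable hR.le u r

/-- Taking primitives intertwines `derivOp` and `opG`. -/
theorem opG_primitive (u : C(Icc (0 : ℝ) R, ℝ)) :
    opG hG.continuous hR.le (primitive hR.le u) = primitive hR.le (derivOp hG hR u) := by
  ext r
  rw [opG_apply, primitive_apply]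
  have h := intervalIntegral.integral_eq_sub_of_hasDerivAt (a := (r : ℝ)) (b := R)
    (f := profile (conv G (radialExt N hR.le (primitive hR.le u))))
    (f' := fun s => -IccExtend hR.le (derivOp hG hR u) s)
    (fun s hs => by
      rw [uIcc_of_le r.2.2] at hs
      have hs' : s ∈ Icc 0 R := ⟨r.2.1.trans hs.1, hs.2⟩
      rw [IccExtend_of_mem hR.le _ hs']
      exact hasDerivAt_profile_conv hG hR u ⟨s, hs'⟩)
    ((continuous_IccExtend hR.le _).neg.intervalIntegrable _ _)
  rw [intervalIntegral.integral_neg] at h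
  linarith

theorem opG_primitive_eq_smul_iff (u : C(Icc (0 : ℝ) R, ℝ)) (μ : ℝ) :
    opG hG.continuous hR.le (primitive hR.le u) = μ • primitive hR.le u ↔
      derivOp hG hR u = μ • u := by
  rw [opG_primitive, ← primitive_smul hR, (primitive_injective hR).eq_iff]

include hG in
theorem contDiffOn_profile_conv (f : Y R) :
    ContDiffOn ℝ 2 (profile (conv G (radialExt N hR.le f))) (Ioo (-(2 * R)) (2 * R)) := by
  have h := contDiffOn_conv (n := 2) hG.contDiff (continuous_radialExt hR.le _) hR
    fun x hx => radialExt_eq_zero hR.le f.2 hx.le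
  refine h.comp (f := fun r : ℝ => r • e1 N) (contDiff_id.smul contDiff_const).contDiffOn
    fun r hr => ?_
  rw [mem_ball_zero_iff, norm_smul, norm_e1, mul_one, Real.norm_eq_abs]
  exact abs_lt.2 hr

include hG in
/-- Eigenfunctions of `opG` for nonzero eigenvalues are continuously differentiable. -/
theorem exists_eq_primitive {f : Y R} {μ : ℝ} (hμ : μ ≠ 0)
    (hf : opG hG.continuous hR.le f = μ • f) : ∃ u, f = primitive hR.le u := by
  set H := profile (conv G (radialExt N hR.le f))
  have hC := contDiffOn_profile_conv hG hR f
  have hsub : Icc (0 : ℝ) R ⊆ Ioo (-(2 * R)) (2 * R) := fun r hr =>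
    ⟨by linarith [hr.1], by linarith [hr.2]⟩
  have hcont : ContinuousOn (deriv H) (Icc 0 R) :=
    (hC.continuousOn_deriv_of_isOpen isOpen_Ioo (by norm_num)).mono hsub
  -- The eigenvalue equation reads μ f = H - H(R) with H of class C² near [0, R], so f' = H'/μ is
  -- continuous.
  let u : C(Icc (0 : ℝ) R, ℝ) := ⟨fun r => -(μ⁻¹ * deriv H r),
    (continuousOn_iff_continuous_domRestrict.1 hcont).const_mul _ |>.neg⟩
  refine ⟨u, ?_⟩
  ext r
  have h := intervalIntegral.integral_eq_sub_of_hasDerivAt (a := (r : ℝ)) (b := R)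
    (f := fun r => -(μ⁻¹ * H r)) (f' := IccExtend hR.le u)
    (fun s hs => by
      rw [uIcc_of_le r.2.2] at hs
      have hs' : s ∈ Icc 0 R := ⟨r.2.1.trans hs.1, hs.2⟩
      rw [IccExtend_of_mem hR.le _ hs']
      exact (((hC.differentiableOn (by norm_num)).differentiableAt
        (isOpen_Ioo.mem_nhds (hsub hs'))).hasDerivAt.const_mul _).neg)
    ((continuous_IccExtend hR.le _).intervalIntegrable _ _)
  have h1 := DFunLike.congr_fun (congrArg Subtype.val hf) r
  rw [opG_apply] at h1
  change H r - H R = μ * (f : C(Icc (0 : ℝ) R, ℝ)) r at h1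
  rw [primitive_apply, h]
  field_simp
  linarith

/-! ### Admissible densities and nonnegative eigenfunctions -/

section Admissible

variable {v : C(Icc (0 : ℝ) R, ℝ)} {ε : ℝ}

theorem solves_radialExt {f : Y R} (hf : opG hG.continuous hR.le f = ε • f) :
    Solves G R (radialExt N hR.le f) ε := by
  intro x hx
  rw [mem_closedBall_zero_iff] at hx
  have h1 := DFunLike.congr_fun (congrArg Subtype.val hf) ⟨‖x‖, norm_nonneg x, hx⟩
  rw [opG_apply] at h1
  rw [(isRadial_conv hG.radial (isRadial_radialExt hR.le _)).eq_profile x, h1, radialExt,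
    IccExtend_of_mem hR.le _ ⟨norm_nonneg x, hx⟩]
  rfl

theorem profile_eq_primitive {ρ : E N → ℝ} (hρ : ρ = radialExt N hR.le (primitive hR.le v))
    (r : Icc (0 : ℝ) R) : profile ρ r = (primitive hR.le v : C(Icc (0 : ℝ) R, ℝ)) r := by
  rw [hρ, profile_radialExt hR.le _ r.2.1, IccExtend_coe]

-- Near 0 the profile is an affine function of the C² function H, and its derivative on [0, R] is
-- -v. Since v(0) = 0 and v ≥ δ r, the right difference quotients of the derivative at 0 are at most
-- -δ.
include hG in
theorem iteratedDeriv_two_profile_neg (hε : 0 < ε) (hv0 : 0 ≤ v) (hvn : v ≠ 0)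
    (hv : derivOp hG hR v = ε • v) :
    iteratedDeriv 2 (profile (radialExt N hR.le (primitive hR.le v))) 0 < 0 := by
  set f := primitive hR.le v
  set H := profile (conv G (radialExt N hR.le f))
  have hf : opG hG.continuous hR.le f = ε • f := (opG_primitive_eq_smul_iff hG hR v ε).2 hv
  have hC := contDiffOn_profile_conv hG hR f
  have heq : profile (radialExt N hR.le f) =ᶠ[𝓝 0] fun r => ε⁻¹ * (H r - H R) := by
    filter_upwards [Icc_mem_nhds (neg_lt_zero.2 hR) hR] with r hr
    have h := solves_radialExt hG hR hf (r • e1 N) (by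
      rw [mem_closedBall_zero_iff, norm_smul, norm_e1, mul_one, Real.norm_eq_abs]
      exact abs_le.2 hr)
    change ε * profile (radialExt N hR.le f) r = H r - H R at h
    rw [← h, inv_mul_cancel_left₀ hε.ne']
  have hderiv : deriv (profile (radialExt N hR.le f)) =ᶠ[𝓝 0] fun r => ε⁻¹ * deriv H r := by
    refine heq.deriv.trans (.of_forall fun r => ?_)
    rw [deriv_const_mul_field, deriv_sub_const]
  rw [iteratedDeriv_succ, iteratedDeriv_one, hderiv.deriv_eq]
  have h0mem : (0 : ℝ) ∈ Ioo (-(2 * R)) (2 * R) := ⟨by linarith, by linarith⟩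
  have hd : DifferentiableAt ℝ (deriv H) 0 :=
    ((hC.deriv_of_isOpen (m := 1) isOpen_Ioo (by norm_num)).differentiableOn
      (by norm_num)).differentiableAt (isOpen_Ioo.mem_nhds h0mem)
  have hval : ∀ r : Icc (0 : ℝ) R, ε⁻¹ * deriv H r = -v r := fun r => by
    rw [(hasDerivAt_profile_conv hG hR v r).deriv, hv, ContinuousMap.smul_apply, smul_eq_mul,
      mul_neg, inv_mul_cancel_left₀ hε.ne']
  obtain ⟨δ, hδ, hlow⟩ :=
    (hG.isPositiveKernel hR).eigenfunction_pos hR (N - 1) hv0 hvn hε hv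
  -- The kernel vanishes at r = 0: T v ≤ C r forces ε v(0) ≤ 0.
  have hv_zero : v ⟨0, le_rfl, hR.le⟩ = 0 := by
    obtain ⟨C, -, hup⟩ := (hG.isPositiveKernel hR).exists_op_le_mul hR (N - 1) v
    have h1 := hup ⟨0, le_rfl, hR.le⟩
    change derivOp hG hR v _ ≤ _ at h1
    rw [hv, ContinuousMap.smul_apply, smul_eq_mul, mul_zero] at h1
    have h2 := ContinuousMap.le_def.1 hv0 ⟨0, le_rfl, hR.le⟩
    exact le_antisymm (nonpos_of_mul_nonpos_right h1 hε) h2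
  have hslope : Tendsto (slope (fun r => ε⁻¹ * deriv H r) 0) (𝓝[>] 0)
      (𝓝 (deriv (fun r => ε⁻¹ * deriv H r) 0)) :=
    (hd.const_mul ε⁻¹).hasDerivAt.tendsto_slope.mono_left
      (nhdsWithin_mono _ fun r (hr : 0 < r) => hr.ne')
  have hle := le_of_tendsto hslope (b := -δ) (by
    filter_upwards [Ioo_mem_nhdsGT hR] with r hr
    have h1 := hval ⟨r, hr.1.le, hr.2.le⟩
    have h2 := hval ⟨0, le_rfl, hR.le⟩
    simp only [hv_zero, neg_zero] at h1 h2
    rw [slope_def_field, h1, h2, sub_zero, sub_zero, div_le_iff₀ hr.1]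
    have := hlow ⟨r, hr.1.le, hr.2.le⟩
    simp only at this
    linarith)
  linarith

theorem isAdmissible_radialExt (hε : 0 < ε) (hv0 : 0 ≤ v) (hvn : v ≠ 0)
    (hv : derivOp hG hR v = ε • v) (hmass : radialMass N hR.le (primitive hR.le v) = 1) :
    IsAdmissible R (radialExt N hR.le (primitive hR.le v)) := by
  have hf := (opG_primitive_eq_smul_iff hG hR v ε).2 hv
  obtain ⟨δ, hδ, hlow⟩ :=
    (hG.isPositiveKernel hR).eigenfunction_pos hR (N - 1) hv0 hvn hε hv
  have hv' : ∀ t : Icc (0 : ℝ) R, 0 < (t : ℝ) → 0 < v t := fun t ht =>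
    (mul_pos hδ ht).trans_le (hlow t)
  refine
    { continuous := continuous_radialExt _ _
      contDiffOn := ?_
      nonneg := fun x => primitive_nonneg hR hv0 _
      integrable := integrable_radialExt hR.le (primitive hR.le v).2
      integral_eq_one := by rw [integral_radialExt, hmass]
      supp_eq := ?_
      radial := isRadial_radialExt _ _
      deriv_nonpos := fun r hr => ?_
      deriv2_neg := iteratedDeriv_two_profile_neg hG hR hε hv0 hvn hv }
  · have h := contDiffOn_conv (n := 2) hG.contDiff
      (continuous_radialExt (N := N) hR.le (primitive hR.le v : C(Icc (0 : ℝ) R, ℝ))) hR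
      fun x hx => radialExt_eq_zero hR.le (primitive hR.le v).2 hx.le
    refine ((contDiffOn_const (c := ε⁻¹)).mul
      ((h.mono (Metric.closedBall_subset_ball (by linarith))).sub
        (contDiffOn_const (c := profile (conv G (radialExt N hR.le (primitive hR.le v))) R)))).congr
        fun x hx => ?_
    have h1 := solves_radialExt hG hR hf x hx
    change _ = ε⁻¹ * (_ - _)
    rw [← h1, inv_mul_cancel_left₀ hε.ne']
  · have hsupp : Function.support (radialExt N hR.le (primitive hR.le v)) = Metric.ball 0 R := by
      ext x
      rw [Function.mem_support, mem_ball_zero_iff]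
      refine ⟨fun h => not_le.1 fun hx => h (radialExt_eq_zero hR.le (primitive hR.le v).2 hx),
        fun hx => ?_⟩
      rw [radialExt, IccExtend_of_mem hR.le _ ⟨norm_nonneg x, hx.le⟩]
      exact (primitive_pos hR hv0 hv' _ hx).ne'
    rw [tsupport, hsupp, closure_ball _ hR.ne']
  · rw [derivWithin_primitive hR (profile_eq_primitive hR rfl) ⟨r, hr⟩, neg_nonpos]
    exact ContinuousMap.le_def.1 hv0 _

/-- An admissible solution is the radial extension of an eigenfunction. -/
theorem IsAdmissible.exists_eigenfunction {ρ : E N → ℝ} (hρ : IsAdmissible R ρ) (hε : 0 < ε)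
    (hsol : Solves G R ρ ε) :
    ∃ u, 0 ≤ u ∧ u ≠ 0 ∧ derivOp hG hR u = ε • u ∧
      radialMass N hR.le (primitive hR.le u) = 1 ∧ ρ = radialExt N hR.le (primitive hR.le u) := by
  have hmem : ∀ r : Icc (0 : ℝ) R, (r : ℝ) • e1 N ∈ Metric.closedBall (0 : E N) R := fun r => by
    rw [mem_closedBall_zero_iff, norm_smul, norm_e1, mul_one, Real.norm_eq_abs,
      abs_of_nonneg r.2.1]
    exact r.2.2
  let f : Y R := ⟨⟨fun r => profile ρ r,
      hρ.continuous.comp (continuous_subtype_val.smul continuous_const)⟩, fun r hr => by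
    -- The boundary condition is part of the equation: at x = R e₁ its right side is 0, and ε > 0.
    have h := hsol _ (hmem r)
    rw [hr] at h
    change ε * _ = profile (conv G ρ) R - profile (conv G ρ) R at h
    rw [sub_self] at h
    change profile ρ r = 0
    rw [hr]
    exact (mul_eq_zero.1 h).resolve_left hε.ne'⟩
  have hext : ρ = radialExt N hR.le f := by
    ext x
    rcases le_or_gt ‖x‖ R with hx | hx
    · rw [radialExt, IccExtend_of_mem hR.le _ ⟨norm_nonneg x, hx⟩]
      exact hρ.radial.eq_profile x
    · rw [radialExt_eq_zero hR.le f.2 hx.le]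
      refine image_eq_zero_of_notMem_tsupport ?_
      rw [hρ.supp_eq, mem_closedBall_zero_iff]
      exact not_le.2 hx
  have hmass : radialMass N hR.le f = 1 := by
    rw [← integral_radialExt, ← hext, hρ.integral_eq_one]
  have hf : opG hG.continuous hR.le f = ε • f := by
    ext r
    rw [opG_apply, ← hext]
    exact (hsol _ (hmem r)).symm
  obtain ⟨u, hu⟩ := exists_eq_primitive hG hR hε.ne' hf
  rw [hu] at hf hmass hext
  refine ⟨u, ContinuousMap.le_def.2 fun r => ?_, fun h0 => ?_,
    (opG_primitive_eq_smul_iff hG hR u ε).1 hf, hmass, hext⟩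
  · have := hρ.deriv_nonpos r r.2
    rw [derivWithin_primitive hR (profile_eq_primitive hR hext)] at this
    exact neg_nonpos.1 this
  · rw [h0, ← zero_smul ℝ (0 : C(Icc (0 : ℝ) R, ℝ)), primitive_smul hR, radialMass_smul hR,
      zero_mul] at hmass
    exact zero_ne_one hmass

end Admissible

/-- Eigenvectors of `opG` for nonzero eigenvalues are primitives of eigenfunctions of `derivOp`. -/
theorem exists_eigenfunction_of_hasEigenvector {f : Y R} {μ : ℝ} (hμ : μ ≠ 0)
    (h : Module.End.HasEigenvector (opG hG.continuous hR.le) μ f) :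
    ∃ u, u ≠ 0 ∧ derivOp hG hR u = μ • u ∧ f = primitive hR.le u := by
  have hf := h.apply_eq_smul
  obtain ⟨u, rfl⟩ := exists_eq_primitive hG hR hμ hf
  refine ⟨u, fun h0 => h.2 ?_, (opG_primitive_eq_smul_iff hG hR u μ).1 hf, rfl⟩
  rw [h0, ← zero_smul ℝ (0 : C(Icc (0 : ℝ) R, ℝ)), primitive_smul hR, zero_smul]

end KreinRutman

end

/-! ### Assembly of the theorem -/

open KreinRutman in
theorem mainTheorem4 (N : ℕ) [NeZero N] (G : KreinRutman.E N → ℝ)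
    (hG : KreinRutman.IsPotential G) (R : ℝ) (hR : 0 < R) :
    IsCompactOperator (KreinRutman.opG hG.continuous hR.le) ∧
    ∃ (ρ : KreinRutman.E N → ℝ) (ε : ℝ),
      KreinRutman.IsAdmissible R ρ ∧ 0 < ε ∧ KreinRutman.Solves G R ρ ε ∧
      (∀ (ρ' : KreinRutman.E N → ℝ) (ε' : ℝ), KreinRutman.IsAdmissible R ρ' → 0 < ε' →
        KreinRutman.Solves G R ρ' ε' → ρ' = ρ ∧ ε' = ε) ∧
      IsGreatest {μ : ℝ | Module.End.HasEigenvalue (KreinRutman.opG hG.continuous hR.le) μ} ε ∧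
      (∀ μ : ℝ, Module.End.HasEigenvalue (KreinRutman.opG hG.continuous hR.le) μ →
        μ ≠ ε → |μ| < ε) ∧
      ∃ f : KreinRutman.Y R,
        (∀ r : Set.Icc (0 : ℝ) R,
          (f : C(Set.Icc (0 : ℝ) R, ℝ)) r = KreinRutman.profile ρ r) ∧
        Module.End.HasEigenvector (KreinRutman.opG hG.continuous hR.le) ε f ∧
        ∀ (f' : KreinRutman.Y R) (ε' : ℝ), f' ≠ f → KreinRutman.radialMass N hR.le f' = 1 →
          Module.End.HasEigenvector (KreinRutman.opG hG.continuous hR.le) ε' f' → |ε'| < ε := by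
  refine ⟨isCompactOperator_opG hG.continuous hR.le, ?_⟩
  have hA := hG.isPositiveKernel hR
  obtain ⟨ε, hε, v, hv0, hvn, hv, hmass⟩ : ∃ ε : ℝ, 0 < ε ∧ ∃ v, 0 ≤ v ∧ v ≠ 0 ∧
      derivOp hG hR v = ε • v ∧ radialMass N hR.le (primitive hR.le v) = 1 := by
    obtain ⟨ε, hε, v, hv0, hvn, hv⟩ := hA.exists_eigenfunction hR (N - 1)
    obtain ⟨δ, hδ, hlow⟩ := hA.eigenfunction_pos hR (N - 1) hv0 hvn hε hv
    have hm := radialMass_primitive_pos (N := N) hR hv0 fun t ht =>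
      (mul_pos hδ ht).trans_le (hlow t)
    -- The eigenfunction is rescaled so that its primitive has mass one; this fixes it uniquely, the
    -- eigenvalue being simple.
    refine ⟨ε, hε, (radialMass N hR.le (primitive hR.le v))⁻¹ • v,
      smul_nonneg (inv_nonneg.2 hm.le) hv0, smul_ne_zero (inv_ne_zero hm.ne') hvn, ?_, ?_⟩
    · rw [map_smul, smul_comm ε]
      exact congrArg _ hv
    · rw [primitive_smul hR, radialMass_smul hR, inv_mul_cancel₀ hm.ne']
  have huniq : ∀ u, derivOp hG hR u = ε • u → radialMass N hR.le (primitive hR.le u) = 1 →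
      u = v := fun u hu hm => by
    obtain ⟨a, rfl⟩ := hA.eigenfunction_unique hR (N - 1) hv0 hvn hε hv hu
    rw [primitive_smul hR, radialMass_smul hR, hmass, mul_one] at hm
    rw [hm, one_smul]
  have hlt : ∀ (f' : Y R) (μ : ℝ), Module.End.HasEigenvector (opG hG.continuous hR.le) μ f' →
      μ ≠ ε → |μ| < ε := fun f' μ hf' hne => by
    -- The eigenvalue 0, whose eigenfunctions need not be primitives, satisfies the bound trivially.
    rcases eq_or_ne μ 0 with rfl | hμ
    · rwa [abs_zero]
    obtain ⟨u, hu, hu', -⟩ := exists_eigenfunction_of_hasEigenvector hG hR hμ hf'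
    obtain ⟨h1, h2⟩ := hA.abs_eigenvalue_le hR (N - 1) hv0 hvn hε hv hu hu'
    exact lt_of_le_of_ne h1 fun h => hne (h2 h).1
  have hlt' : ∀ μ : ℝ, Module.End.HasEigenvalue (opG hG.continuous hR.le) μ →
      μ ≠ ε → |μ| < ε := fun μ hμ hne => by
    obtain ⟨f', hf'⟩ := hμ.exists_hasEigenvector
    exact hlt f' μ hf' hne
  have hf := (opG_primitive_eq_smul_iff hG hR v ε).2 hv
  have hvec : Module.End.HasEigenvector (opG hG.continuous hR.le) ε (primitive hR.le v) :=
    ⟨Module.End.mem_eigenspace_iff.2 hf, fun h0 => by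
      rw [h0, ← zero_smul ℝ (0 : Y R), radialMass_smul hR, zero_mul] at hmass
      exact zero_ne_one hmass⟩
  refine ⟨radialExt N hR.le (primitive hR.le v), ε,
    isAdmissible_radialExt hG hR hε hv0 hvn hv hmass, hε, solves_radialExt hG hR hf, ?_,
    ⟨Module.End.hasEigenvalue_of_hasEigenvector hvec, fun μ hμ => ?_⟩, hlt',
    primitive hR.le v, fun r => (profile_eq_primitive hR rfl r).symm, hvec, ?_⟩
  · intro ρ' ε' hρ' hε' hsol
    obtain ⟨u, hu0, hun, hu, hm, rfl⟩ := hρ'.exists_eigenfunction hG hR hε' hsol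
    have heq := hA.eigenvalue_eq_of_nonneg hR (N - 1) hv0 hvn hε hv hu0 hun hu
    rw [heq] at hu
    rw [huniq u hu hm]
    exact ⟨rfl, heq⟩
  · by_cases h : μ = ε
    · exact h.le
    · exact (le_abs_self μ).trans (hlt' μ hμ h).le
  · intro f' ε' hne hm hf'
    refine hlt f' ε' hf' fun h => hne ?_
    rw [h] at hf'
    obtain ⟨u, -, hu, rfl⟩ := exists_eigenfunction_of_hasEigenvector hG hR hε.ne' hf'
    rw [huniq u hu hm]
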